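/- **Proposition 4.1.** Let $X$ be a complex Banach space and let $-A$ be the generator of a bounded $C_0$-semigroup $(e^{-tA})_{t\ge 0}$ on $X$, with $\overline{\operatorname{ran}(A)}=X$. *Notation.* Let $\mathbb C_+=\{z\in\mathbb C:\operatorname{Re} z>0\}$, and let $\mathrm A^1_+(\mathbb C_+)$ be the algebra of Laplace transforms $g(z)=\int_{[0,\infty)}e^{-sz}\,\mu(ds)$, $z\in\mathbb C_+$, of bounded complex Radon measures $\mu$ on $[0,\infty)$; for such $g$ put $g(A)x=\int_{[0,\infty)}e^{-sA}x\,\mu(ds)$, $x\in X$. A holomorphic $f:\mathbb C_+\to\mathbb C$ is *regularizable by* $e\in\mathrm A^1_+(\mathbb C_+)$ if $ef\in \mathrm A^1_+(\mathbb C_+)$ and $e(A)$ is injective; it belongs to the *extended Hille–Phillips calculus* if such an $e$ exists, and then $f(A):=e(A)^{-1}(ef)(A)$ with domain $\{x\in X:(ef)(A)x\in\operatorname{ran}(e(A))\}$, which is a closed operator independent of the choice of $e$. A subspace of $\operatorname{dom}(f(A))$ is a *core* for $f(A)$ if $f(A)$ is the closure of its restriction to that subspace. The operator $A^2$ has its natural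 domain $\{x\in \operatorname{dom}(A): Ax\in\operatorname{dom}(A)\}$. For $\alpha>0$ let $\mathcal S_\alpha$ be the class of functions $f(z)=a+\int_{[0,\infty)}(z+\tau)^{-\alpha}\,\mu(d\tau)$, $z>0$, with $a\ge 0$ and $\mu$ a positive Radon measure on $[0,\infty)$ satisfying $\int_{[0,\infty)}(1+\tau)^{-\alpha}\,\mu(d\tau)<\infty$, where $f$ is identified with its analytic extension to $\mathbb C\setminus(-\infty,0]$. Let $\tilde{\mathcal S}_2=\{f_1f_2: f_1,f_2\in\mathcal S_1\}$. 1. If $f\in\mathcal S_2$, then $f$ is regularizable by $e(z)=z^2/(1+z)^2\in \mathrm A^1_+(\mathbb C_+)$, and thus belongs to the extended Hille–Phillips calculus. Moreover, $\operatorname{ran}(A^2)$ is a core for $f(A)$. 2. If $f\in\tilde{\mathcal S}_2$ and $f\ne 0$, then $1/f$ is regularizable by $e(z)=1/(1+z)^2\in \mathrm A^1_+(\mathbb C_+)$, and hence belongs to the extended Hille–Phillips calculus. Moreover, $\operatorname{dom}(A^2)$ is a core for $(1/f)(A)$. -/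

import Mathlib

open Filter Topology MeasureTheory
open scoped NNReal

/-- The open right half-plane `ℂ₊ = {z : Re z > 0}`. -/
def rightHalfPlane : Set ℂ := {z | 0 < z.re}

/-! ### Composition of unbounded operators -/

namespace LinearPMap

variable {X : Type*} [AddCommGroup X] [Module ℂ X]

/-- The product `g f` of two unbounded operators, with its natural (maximal) domain
`{x ∈ dom f : f x ∈ dom g}`. -/
def pcomp (g f : X →ₗ.[ℂ] X) : X →ₗ.[ℂ] X :=
  g.comp (f.domRestrict ((g.domain.comap f.toFun).map f.domain.subtype)) (by
    rintro ⟨x, hx⟩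
    obtain ⟨⟨y, hy, rfl⟩, _⟩ := hx
    exact hy)

theorem mem_graph_pcomp (g f : X →ₗ.[ℂ] X) (x z : X) :
    (x, z) ∈ (g.pcomp f).graph ↔ ∃ y, (x, y) ∈ f.graph ∧ (y, z) ∈ g.graph := by
  simp only [mem_graph_iff]
  constructor
  · rintro ⟨⟨w, hw⟩, rfl, rfl⟩
    obtain ⟨⟨y, hy, rfl⟩, hw'⟩ := hw
    exact ⟨f y, ⟨y, rfl, rfl⟩, ⟨f y, hy⟩, rfl, rfl⟩
  · rintro ⟨y, ⟨a, rfl, rfl⟩, ⟨b, hb, rfl⟩⟩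
    have ha : (a : X) ∈ (g.domain.comap f.toFun).map f.domain.subtype :=
      ⟨a, by
        change f a ∈ g.domain
        rw [← hb]
        exact b.2, rfl⟩
    refine ⟨⟨a, ha, a.2⟩, rfl, ?_⟩
    exact congrArg g (Subtype.ext hb.symm)

end LinearPMap

/-! ### Integration against complex measures -/

/-- The pairing `(x, c) ↦ c • x`, used to integrate `E`-valued functions against complex
measures. -/
noncomputable def smulPairing (E : Type*) [NormedAddCommGroup E] [NormedSpace ℂ E] :
    E →L[ℝ] ℂ →L[ℝ] E :=
  (ContinuousLinearMap.lsmul ℝ ℂ : ℂ →L[ℝ] E →L[ℝ] E).flip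

theorem smulPairing_apply {E : Type*} [NormedAddCommGroup E] [NormedSpace ℂ E] (x : E) (c : ℂ) :
    smulPairing E x c = c • x := rfl

/-- Complex measures have finite total variation. -/
instance complexMeasure_isFiniteMeasure_variation {α : Type*} [MeasurableSpace α]
    (μ : ComplexMeasure α) : IsFiniteMeasure μ.variation := by
  have h : μ.variation ≤ (ComplexMeasure.re μ).totalVariation +
      (ComplexMeasure.im μ).totalVariation := by
    apply VectorMeasure.variation_le_of_forall_enorm_le
    intro s _
    have h1 := SignedMeasure.enorm_le_totalVariation (ComplexMeasure.re μ) s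
    have h2 := SignedMeasure.enorm_le_totalVariation (ComplexMeasure.im μ) s
    have h3 : ‖μ s‖ₑ ≤ ‖(ComplexMeasure.re μ) s‖ₑ + ‖(ComplexMeasure.im μ) s‖ₑ := by
      simp only [enorm_eq_nnnorm]
      exact_mod_cast Complex.norm_le_abs_re_add_abs_im (μ s)
    rw [Measure.add_apply]
    exact h3.trans (add_le_add h1 h2)
  exact isFiniteMeasure_of_le _ h

/-- The Laplace transform `(ℒμ)(z) = ∫ e^{-sz} μ(ds)` of a complex (that is, bounded Radon)
measure on `[0, ∞)`. -/
noncomputable def laplace (μ : ComplexMeasure ℝ≥0) (z : ℂ) : ℂ :=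
  μ.integral (fun s : ℝ≥0 => Complex.exp (-((s : ℝ) : ℂ) * z)) (smulPairing ℂ)

/-- On the right half-plane, `g` is the Laplace transform of `μ`. -/
def IsLaplaceOf (g : ℂ → ℂ) (μ : ComplexMeasure ℝ≥0) : Prop :=
  ∀ z ∈ rightHalfPlane, g z = laplace μ z

/-- Membership in the algebra `A¹₊(ℂ₊)` of Laplace transforms of bounded Radon measures on
`[0, ∞)`. Only the values on `ℂ₊` matter. -/
def MemA1 (g : ℂ → ℂ) : Prop := ∃ μ : ComplexMeasure ℝ≥0, IsLaplaceOf g μ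

/-! ### Bounded semigroups and the extended Hille-Phillips calculus -/

/-- A bounded `C₀`-semigroup on `X`. -/
structure BoundedC0Semigroup (X : Type*) [NormedAddCommGroup X] [NormedSpace ℂ X] where
  /-- the operators of the semigroup -/
  op : ℝ≥0 → X →L[ℂ] X
  op_zero : op 0 = 1
  op_add : ∀ s t, op (s + t) = op s * op t
  continuous_op : ∀ x, Continuous fun t => op t x
  bounded : ∃ M : ℝ, ∀ t, ‖op t‖ ≤ M

namespace BoundedC0Semigroup

variable {X : Type*} [NormedAddCommGroup X] [NormedSpace ℂ X] (T : BoundedC0Semigroup X)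

/-- The graph of the generator: the pairs `(x, y)` with `(T(t)x - x) / t → y` as `t → 0+`. -/
def generatorGraph : Submodule ℂ (X × X) where
  carrier := {p | Tendsto (fun t : ℝ≥0 => (t : ℝ)⁻¹ • (T.op t p.1 - p.1)) (𝓝[>] 0) (𝓝 p.2)}
  zero_mem' := by simp
  add_mem' := by
    intro p q hp hq
    have h := Tendsto.add hp hq
    refine h.congr fun t => ?_
    rw [← smul_add, Prod.fst_add, map_add, add_sub_add_comm]
  smul_mem' := by
    intro c p hp
    have h := Tendsto.const_smul hp c
    refine h.congr fun t => ?_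
    rw [smul_comm, Prod.smul_fst, map_smul, smul_sub]

/-- The generator of the semigroup, as an unbounded operator. -/
noncomputable def generator : X →ₗ.[ℂ] X := T.generatorGraph.toLinearPMap

theorem mem_graph_generator (x y : X) :
    (x, y) ∈ T.generator.graph ↔
      Tendsto (fun t : ℝ≥0 => (t : ℝ)⁻¹ • (T.op t x - x)) (𝓝[>] 0) (𝓝 y) := by
  rw [generator, Submodule.toLinearPMap_graph_eq]
  · rfl
  · rintro ⟨x, y⟩ h hx
    obtain rfl : x = 0 := hx
    have h' : Tendsto (fun t : ℝ≥0 => (t : ℝ)⁻¹ • (T.op t (0 : X) - 0)) (𝓝[>] 0) (𝓝 y) := h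
    simp only [map_zero, sub_zero, smul_zero] at h'
    exact (tendsto_const_nhds_iff.mp h').symm

theorem integrable_op (μ : ComplexMeasure ℝ≥0) (x : X) :
    μ.Integrable (fun s => T.op s x) := by
  obtain ⟨M, hM⟩ := T.bounded
  refine MeasureTheory.Integrable.of_bound
    (T.continuous_op x).aestronglyMeasurable (M * ‖x‖) ?_
  exact Eventually.of_forall fun s => (T.op s).le_of_opNorm_le (hM s) x

/-- The bounded operator `x ↦ ∫ T(s)x μ(ds)`. -/
noncomputable def hpOperator (μ : ComplexMeasure ℝ≥0) : X →L[ℂ] X :=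
  LinearMap.mkContinuousOfExistsBound
    { toFun := fun x => μ.integral (fun s => T.op s x) (smulPairing X)
      map_add' := fun x y => by
        simp only [map_add]
        exact VectorMeasure.integral_fun_add (T.integrable_op μ x) (T.integrable_op μ y)
      map_smul' := fun c x => by
        simp only [map_smul, RingHom.id_apply, VectorMeasure.integral_eq_setToFun]
        refine setToFun_smul _ (fun c s x => ?_) c _
        change smulPairing X (c • x) (μ s) = c • smulPairing X x (μ s)
        rw [smulPairing_apply, smulPairing_apply, smul_comm] }
    (by
      obtain ⟨M, hM⟩ := T.bounded
      refine ⟨‖smulPairing X‖ * M * μ.variation.real Set.univ, fun x => ?_⟩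
      refine (VectorMeasure.norm_integral_le_of_norm_le_const (C := M * ‖x‖)
        (Eventually.of_forall fun s => (T.op s).le_of_opNorm_le (hM s) x)).trans_eq ?_
      ring)

theorem hpOperator_apply (μ : ComplexMeasure ℝ≥0) (x : X) :
    T.hpOperator μ x = μ.integral (fun s => T.op s x) (smulPairing X) := rfl

open scoped Classical in
/-- The Hille-Phillips calculus: `g(A) x = ∫ T(s)x μ(ds)` for `g = ℒμ ∈ A¹₊(ℂ₊)`, where `-A` is the
generator of `T`. (The measure is determined by `g`, as the Laplace transform is injective; the
value for `g ∉ A¹₊(ℂ₊)` is irrelevant.) -/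
noncomputable def hp (g : ℂ → ℂ) : X →L[ℂ] X :=
  if h : MemA1 g then T.hpOperator h.choose else 0

/-- The holomorphic function `f` on `ℂ₊` is regularizable by `e`. -/
structure IsRegularizer (e f : ℂ → ℂ) : Prop where
  holomorphic : DifferentiableOn ℂ f rightHalfPlane
  memA1 : MemA1 e
  memA1_mul : MemA1 (fun z => e z * f z)
  injective : Function.Injective (T.hp e)

/-- `f` belongs to the domain of the extended Hille-Phillips calculus. -/
def IsRegularizable (f : ℂ → ℂ) : Prop := ∃ e, T.IsRegularizer e f

/-- The operator `e(A)⁻¹ (e f)(A)`, with domain `{x : (e f)(A) x ∈ ran e(A)}`. -/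
noncomputable def regularizedBy (e f : ℂ → ℂ) : X →ₗ.[ℂ] X :=
  ((T.hp e).toLinearMap.toPMap ⊤).inverse.pcomp
    ((T.hp fun z => e z * f z).toLinearMap.toPMap ⊤)

open scoped Classical in
/-- The extended Hille-Phillips calculus: `f(A) = e(A)⁻¹ (e f)(A)` for any regularizer `e` of `f`
(the operator does not depend on the regularizer), where `-A` is the generator of `T`. The value
for non-regularizable `f` is irrelevant. -/
noncomputable def extHP (f : ℂ → ℂ) : X →ₗ.[ℂ] X :=
  if h : T.IsRegularizable f then T.regularizedBy h.choose f else ⊥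

end BoundedC0Semigroup

/-! ### Generalized Stieltjes functions -/

/-- `f` is (the analytic extension to `ℂ \ (-∞, 0]` of) a generalized Stieltjes function of
order `α`: `f(x) = a + ∫_{[0,∞)} (x + τ)^{-α} μ(dτ)` for `x > 0`, with `a ≥ 0` and `μ` a positive
measure on `[0, ∞)` with `∫ (1 + τ)^{-α} μ(dτ) < ∞` (such a measure is automatically Radon). The
values of `f` outside `ℂ \ (-∞, 0]` are irrelevant. -/
def IsGenStieltjes (α : ℝ) (f : ℂ → ℂ) : Prop :=
  DifferentiableOn ℂ f Complex.slitPlane ∧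
  ∃ (a : ℝ) (μ : Measure ℝ≥0), 0 ≤ a ∧
    Integrable (fun τ : ℝ≥0 => 1 / (1 + (τ : ℝ)) ^ α) μ ∧
    ∀ x : ℝ, 0 < x → f (x : ℂ) = ((a + ∫ τ : ℝ≥0, 1 / (x + (τ : ℝ)) ^ α ∂μ : ℝ) : ℂ)

/-- `f` is a product of two Stieltjes functions (generalized Stieltjes functions of order `1`). -/
def IsStieltjesProd (f : ℂ → ℂ) : Prop :=
  ∃ f₁ f₂ : ℂ → ℂ, IsGenStieltjes 1 f₁ ∧ IsGenStieltjes 1 f₂ ∧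
    ∀ z ∈ Complex.slitPlane, f z = f₁ z * f₂ z

/-! ### Complex measures as combinations of positive measures -/

/-! Write `R(l) = (l + A)⁻¹`, the Hille–Phillips operator of `1 / (l + z)`. Multiplicativity of the
calculus (convolution of measures, after splitting complex measures into positive ones) turns the
two regularizers into `(1 - R(1))²` and `R(1)²`. The second is injective because `R(1)` is a
resolvent, the first because dense range of `A` forces `ker A = 0`.

Cores. The graph of `f(A)` is `{(x, y) : (ef)(A) x = e(A) y}`. If bounded operators `Q n` commute
with both sides, map into `S ⊆ dom f(A)` and tend strongly to the identity, then `S` is a core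
(`LinearPMap.hasCore_of_approx`). For `ran(A²)` take `(1 - l R(l))² = (A R(l))²` with `l → 0`, for
`dom(A²)` take `(l R(l))²` with `l → ∞`.

Regularizability. The substitution `t = 1 / (1 + τ)` writes a function of `S_α` as `∫ (t x + 1 -
t)^{-α} ρ(dt)` with `ρ` finite on `[0, 1]`; the constant `a` becomes the mass at `t = 0`. The
function `z / ((1 + z)(t z + 1 - t))` is a Laplace transform with total variation bounded uniformly
in `t` (`exists_isLaplaceFamily_sub`). Its square, integrated against `ρ`, settles order `2`.

For reciprocals, a nonzero Stieltjes function satisfies `1 / f(x) = x ∫ (t x + 1 - t)⁻¹ σ(dt)` for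
another finite `σ` (`exists_measure_reciprocal`), so `1 / ((1 + z) f)` is an integral of the same
function of `z`, and a product of two Stieltjes functions follows by convolution. The measure `σ` is
found by linear algebra for discrete `ρ`, and by weak compactness in general. -/

section Bridge

/-- The complex measure `c • p` for a positive finite measure `p`. -/
noncomputable def ofMeasure {α : Type*} [MeasurableSpace α] (c : ℂ) (p : Measure α)
    [IsFiniteMeasure p] : ComplexMeasure α :=
  p.toSignedMeasure.mapRange
    ((ContinuousLinearMap.toSpanSingleton ℝ c : ℝ →L[ℝ] ℂ) : ℝ →ₗ[ℝ] ℂ).toAddMonoidHom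
    (ContinuousLinearMap.toSpanSingleton ℝ c).continuous

variable {α : Type*} [MeasurableSpace α]

theorem ofMeasure_apply (c : ℂ) (p : Measure α) [IsFiniteMeasure p] {s : Set α}
    (hs : MeasurableSet s) : ofMeasure c p s = p.real s * c := by
  simp [ofMeasure, VectorMeasure.mapRange_apply, Measure.toSignedMeasure_apply_measurable hs]

theorem variation_ofMeasure_le (c : ℂ) (p : Measure α) [IsFiniteMeasure p] :
    (ofMeasure c p).variation ≤ ‖c‖₊ • p := by
  apply VectorMeasure.variation_le_of_forall_enorm_le
  intro s hs
  rw [ofMeasure_apply c p hs, Measure.smul_apply, enorm_mul, mul_comm]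
  simp [enorm_eq_nnnorm, ENNReal.smul_def, Measure.real, ENNReal.toReal]

variable {E : Type*} [NormedAddCommGroup E] [NormedSpace ℂ E]

omit [NormedSpace ℂ E] in
theorem integrable_ofMeasure {c : ℂ} {p : Measure α} [IsFiniteMeasure p] {F : α → E}
    (hF : Integrable F p) : (ofMeasure c p).Integrable F :=
  (hF.smul_measure_nnreal (c := ‖c‖₊)).mono_measure (variation_ofMeasure_le c p)

theorem integral_ofMeasure [CompleteSpace E] (c : ℂ) (p : Measure α) [IsFiniteMeasure p]
    {F : α → E} (hF : Integrable F p) :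
    (ofMeasure c p).integral F (smulPairing E) = c • ∫ s, F s ∂p := by
  have h1 : p.toSignedMeasure.Integrable F := by
    rw [VectorMeasure.Integrable, Measure.variation_toSignedMeasure]
    exact hF
  rw [← VectorMeasure.integral_toSignedMeasure]
  change _ = (ContinuousLinearMap.lsmul ℝ ℂ c : E →L[ℝ] E) _
  rw [VectorMeasure.continuousLinearMap_apply_integral h1,
    VectorMeasure.integral_eq_setToFun_transpose (integrable_ofMeasure hF),
    VectorMeasure.integral_eq_setToFun_transpose h1]
  -- Both sides are integrals of `F` against operator-valued measures, and these two measures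
  -- coincide.
  have : (ofMeasure c p).transpose (smulPairing E) = p.toSignedMeasure.transpose
      ((ContinuousLinearMap.compL ℝ ℝ E E (ContinuousLinearMap.lsmul ℝ ℂ c)) ∘L
        (ContinuousLinearMap.lsmul ℝ ℝ).flip) := by
    ext s hs x
    change (p.toSignedMeasure s • c) • x = c • (p.toSignedMeasure s • x)
    rw [smul_assoc, smul_comm]
  congr!

theorem integral_sum_ofMeasure [CompleteSpace E] {ι : Type*} [Fintype ι] (c : ι → ℂ)
    (p : ι → Measure α) [∀ i, IsFiniteMeasure (p i)] {F : α → E}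
    (hF : ∀ i, Integrable F (p i)) :
    (∑ i, ofMeasure (c i) (p i)).integral F (smulPairing E) = ∑ i, c i • ∫ s, F s ∂(p i) := by
  rw [VectorMeasure.integral_finsetSum_vectorMeasure]
  · exact Finset.sum_congr rfl fun i _ => integral_ofMeasure _ _ (hF i)
  · exact fun i _ => integrable_ofMeasure (hF i)

/-- The coefficients of the four positive parts of a complex measure. -/
noncomputable def partCoeff : Fin 4 → ℂ := ![1, -1, Complex.I, -Complex.I]

theorem exists_eq_sum_ofMeasure (ν : ComplexMeasure α) :
    ∃ (p : Fin 4 → Measure α) (_ : ∀ i, IsFiniteMeasure (p i)),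
      ν = ∑ i, ofMeasure (partCoeff i) (p i) := by
  refine ⟨![(ComplexMeasure.re ν).toJordanDecomposition.posPart,
    (ComplexMeasure.re ν).toJordanDecomposition.negPart,
    (ComplexMeasure.im ν).toJordanDecomposition.posPart,
    (ComplexMeasure.im ν).toJordanDecomposition.negPart], ?_, ?_⟩
  · intro i
    fin_cases i
    · exact (ComplexMeasure.re ν).toJordanDecomposition.posPart_finite
    · exact (ComplexMeasure.re ν).toJordanDecomposition.negPart_finite
    · exact (ComplexMeasure.im ν).toJordanDecomposition.posPart_finite
    · exact (ComplexMeasure.im ν).toJordanDecomposition.negPart_finite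
  · ext s hs
    have hre : (ν s).re = (ComplexMeasure.re ν).toJordanDecomposition.toSignedMeasure s := by
      rw [SignedMeasure.toSignedMeasure_toJordanDecomposition]; rfl
    have him : (ν s).im = (ComplexMeasure.im ν).toJordanDecomposition.toSignedMeasure s := by
      rw [SignedMeasure.toSignedMeasure_toJordanDecomposition]; rfl
    rw [JordanDecomposition.toSignedMeasure, sub_apply,
      Measure.toSignedMeasure_apply_measurable hs,
      Measure.toSignedMeasure_apply_measurable hs] at hre him
    simp only [Fin.sum_univ_four, add_apply, partCoeff]
    apply Complex.ext
    · rw [hre]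
      simp [ofMeasure_apply _ _ hs, sub_eq_add_neg]
    · rw [him]
      simp [ofMeasure_apply _ _ hs, sub_eq_add_neg]

end Bridge

/-! ### Laplace transforms -/

section Laplace

theorem continuous_laplace_kernel (z : ℂ) :
    Continuous (fun s : ℝ≥0 => Complex.exp (-((s : ℝ) : ℂ) * z)) := by fun_prop

theorem norm_laplace_kernel_le {z : ℂ} (hz : 0 ≤ z.re) (s : ℝ≥0) :
    ‖Complex.exp (-((s : ℝ) : ℂ) * z)‖ ≤ 1 := by
  rw [Complex.norm_exp]
  simp only [neg_mul, Complex.neg_re, Complex.re_ofReal_mul, Real.exp_le_one_iff,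
    Left.neg_nonpos_iff]
  positivity

theorem integrable_laplace_kernel {z : ℂ} (hz : 0 ≤ z.re) (p : Measure ℝ≥0) [IsFiniteMeasure p] :
    Integrable (fun s : ℝ≥0 => Complex.exp (-((s : ℝ) : ℂ) * z)) p :=
  Integrable.of_bound (continuous_laplace_kernel z).aestronglyMeasurable 1
    (Eventually.of_forall (norm_laplace_kernel_le hz))

theorem laplace_sum_ofMeasure {ι : Type*} [Fintype ι] (c : ι → ℂ)
    (p : ι → Measure ℝ≥0) [∀ i, IsFiniteMeasure (p i)] {z : ℂ} (hz : 0 ≤ z.re) :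
    laplace (∑ i, ofMeasure (c i) (p i)) z =
      ∑ i, c i * ∫ s : ℝ≥0, Complex.exp (-((s : ℝ) : ℂ) * z) ∂(p i) := by
  rw [laplace, integral_sum_ofMeasure c p fun i => integrable_laplace_kernel hz (p i)]
  rfl

theorem laplace_ofMeasure (c : ℂ) (p : Measure ℝ≥0) [IsFiniteMeasure p] {z : ℂ} (hz : 0 ≤ z.re) :
    laplace (ofMeasure c p) z = c * ∫ s : ℝ≥0, Complex.exp (-((s : ℝ) : ℂ) * z) ∂p :=
  integral_ofMeasure c p (integrable_laplace_kernel hz p)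

theorem integral_laplace_kernel_ofReal (p : Measure ℝ≥0) (x : ℝ) :
    ∫ s : ℝ≥0, Complex.exp (-((s : ℝ) : ℂ) * x) ∂p =
      ((∫ s : ℝ≥0, Real.exp (-(s : ℝ) * x) ∂p : ℝ) : ℂ) := by
  rw [← integral_complex_ofReal]
  congr 1 with s
  push_cast
  rfl

theorem isOpen_rightHalfPlane : IsOpen rightHalfPlane :=
  isOpen_lt continuous_const Complex.continuous_re

/-- Each positive part contributes the complex moment generating function of `s ↦ -s`, which is
holomorphic wherever the real part is interior to the set of convergence. -/
theorem differentiableOn_laplace (ν : ComplexMeasure ℝ≥0) :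
    DifferentiableOn ℂ (laplace ν) rightHalfPlane := by
  obtain ⟨p, hp, rfl⟩ := exists_eq_sum_ofMeasure ν
  have key : ∀ i, DifferentiableOn ℂ
      (fun z => ∫ s : ℝ≥0, Complex.exp (-((s : ℝ) : ℂ) * z) ∂(p i)) rightHalfPlane := by
    intro i z hz
    have h1 : Set.Ici (0 : ℝ) ⊆ ProbabilityTheory.integrableExpSet (fun s : ℝ≥0 => -(s : ℝ)) (p i) := by
      intro t ht
      refine Integrable.of_bound (by fun_prop) 1 (Eventually.of_forall fun s => ?_)
      rw [Real.norm_eq_abs, Real.abs_exp, Real.exp_le_one_iff]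
      have : 0 ≤ t * s := mul_nonneg ht s.2
      linarith
    have h2 : z.re ∈ interior (ProbabilityTheory.integrableExpSet (fun s : ℝ≥0 => -(s : ℝ)) (p i)) := by
      apply interior_mono h1
      rw [interior_Ici]
      exact hz
    have h3 := (ProbabilityTheory.hasDerivAt_complexMGF h2).differentiableAt
    refine (h3.congr_of_eventuallyEq (Eventually.of_forall fun w => ?_)).differentiableWithinAt
    simp only [ProbabilityTheory.complexMGF, Complex.ofReal_neg, mul_comm]
  refine (DifferentiableOn.fun_sum (u := Finset.univ) fun i _ =>
    (key i).const_mul (partCoeff i)).congr fun z hz => ?_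
  exact laplace_sum_ofMeasure _ p (le_of_lt hz)

/-- Two holomorphic functions on the right half-plane which agree on the positive reals agree. -/
theorem eqOn_rightHalfPlane_of_eq_ofReal {f g : ℂ → ℂ} (hf : DifferentiableOn ℂ f rightHalfPlane)
    (hg : DifferentiableOn ℂ g rightHalfPlane) (h : ∀ x : ℝ, 0 < x → f x = g x) :
    Set.EqOn f g rightHalfPlane := by
  have hpre : IsPreconnected rightHalfPlane :=
    (convex_halfSpace_re_gt 0).isPreconnected
  refine (hf.analyticOnNhd isOpen_rightHalfPlane).eqOn_of_preconnected_of_frequently_eq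
    (hg.analyticOnNhd isOpen_rightHalfPlane) hpre (z₀ := 1) (by simp [rightHalfPlane]) ?_
  have ht : Tendsto (fun n : ℕ => ((1 + 1 / ((n : ℝ) + 1) : ℝ) : ℂ)) atTop (𝓝[≠] 1) := by
    rw [tendsto_nhdsWithin_iff]
    constructor
    · have h1 := (tendsto_one_div_add_atTop_nhds_zero_nat (𝕜 := ℝ)).const_add 1
      rw [add_zero] at h1
      simpa [Function.comp_def] using (Complex.continuous_ofReal.tendsto 1).comp h1
    · refine Eventually.of_forall fun n => ?_
      have : (0 : ℝ) < 1 / ((n : ℝ) + 1) := by positivity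
      simp only [Set.mem_compl_iff, Set.mem_singleton_iff]
      norm_cast
      push_cast
      linarith
  exact ht.frequently (Frequently.of_forall fun n => h _ (by positivity))

/-- A finite positive measure on `[0, ∞)` is determined by its Laplace transform. -/
theorem measure_ext_of_laplace {P Q : Measure ℝ≥0} [IsFiniteMeasure P] [IsFiniteMeasure Q]
    (h : ∀ x : ℝ, 0 < x → ∫ s : ℝ≥0, Real.exp (-(s : ℝ) * x) ∂P
      = ∫ s : ℝ≥0, Real.exp (-(s : ℝ) * x) ∂Q) : P = Q := by
  -- The hypothesis omits `x = 0`; equality of total masses is recovered as a limit.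
  have h0 : ∀ (P : Measure ℝ≥0) [IsFiniteMeasure P], Tendsto
      (fun n : ℕ => ∫ s : ℝ≥0, Real.exp (-(s : ℝ) * (1 / ((n : ℝ) + 1))) ∂P) atTop
      (𝓝 (∫ s : ℝ≥0, Real.exp (-(s : ℝ) * 0) ∂P)) := by
    intro P _
    refine tendsto_integral_of_dominated_convergence (fun _ => 1) (fun n => by fun_prop)
      (integrable_const _) (fun n => Eventually.of_forall fun s => ?_)
      (Eventually.of_forall fun s => ?_)
    · rw [Real.norm_eq_abs, Real.abs_exp, Real.exp_le_one_iff]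
      have : 0 ≤ (s : ℝ) * (1 / ((n : ℝ) + 1)) := by positivity
      linarith
    · exact (Real.continuous_exp.tendsto _).comp
        ((tendsto_one_div_add_atTop_nhds_zero_nat (𝕜 := ℝ)).const_mul _)
  have hn : ∀ n : ℕ, ∫ s : ℝ≥0, Real.exp (-(s : ℝ)) ^ n ∂P
      = ∫ s : ℝ≥0, Real.exp (-(s : ℝ)) ^ n ∂Q := by
    intro n
    have h1 : ∀ s : ℝ≥0, Real.exp (-(s : ℝ)) ^ n = Real.exp (-(s : ℝ) * n) := fun s => by
      rw [mul_comm, Real.exp_nat_mul]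
    simp only [h1]
    rcases Nat.eq_zero_or_pos n with rfl | hn
    · rw [Nat.cast_zero]
      refine tendsto_nhds_unique (h0 P) ((h0 Q).congr fun n => (h _ ?_).symm)
      positivity
    · exact h n (by exact_mod_cast hn)
  let e : BoundedContinuousFunction ℝ≥0 ℝ :=
    BoundedContinuousFunction.ofNormedAddCommGroup (fun s : ℝ≥0 => Real.exp (-(s : ℝ)))
      (by fun_prop) 1 (fun s => by
        rw [Real.norm_eq_abs, Real.abs_exp, Real.exp_le_one_iff]
        simp)
  have he : ∀ s, e s = Real.exp (-(s : ℝ)) := fun s => rfl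
  -- Polynomials in `e^{-s}` separate points, and their integrals are combinations of the values of
  -- the Laplace transform at the integers `n ≥ 0`.
  let A : StarSubalgebra ℝ (BoundedContinuousFunction ℝ≥0 ℝ) :=
    { Algebra.adjoin ℝ {e} with
      star_mem' := fun {a} ha => by
        have : star a = a := by
          ext s
          exact star_trivial (a s)
        rwa [this] }
  refine ext_of_forall_mem_subalgebra_integral_eq_of_pseudoEMetric_complete_countable
    (A := A) ?_ ?_
  · intro x y hxy
    refine ⟨e, ⟨e.toContinuousMap, ⟨e, Algebra.subset_adjoin rfl, rfl⟩, rfl⟩, ?_⟩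
    rw [he, he]
    intro hh
    apply hxy
    have := Real.exp_injective hh
    exact NNReal.coe_injective (neg_injective this)
  · intro g hg
    have hg' : g ∈ Algebra.adjoin ℝ {e} := hg
    rw [Algebra.adjoin_singleton_eq_range_aeval] at hg'
    obtain ⟨q, rfl⟩ := hg'
    induction q using Polynomial.induction_on' with
    | add q r hq hr =>
      have hmem : ∀ q : Polynomial ℝ, Polynomial.aeval e q ∈ A := fun q => by
        change _ ∈ Algebra.adjoin ℝ {e}
        rw [Algebra.adjoin_singleton_eq_range_aeval]
        exact ⟨q, rfl⟩
      simp only [map_add, BoundedContinuousFunction.coe_add, Pi.add_apply]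
      rw [integral_add (BoundedContinuousFunction.integrable _ _)
        (BoundedContinuousFunction.integrable _ _), integral_add
        (BoundedContinuousFunction.integrable _ _) (BoundedContinuousFunction.integrable _ _)]
      exact congrArg₂ _ (hq (hmem q)) (hr (hmem r))
    | monomial n a =>
      have h2 : ∀ s, (Polynomial.aeval e (Polynomial.monomial n a)) s
          = a * Real.exp (-(s : ℝ)) ^ n := fun s => by
        rw [Polynomial.aeval_monomial]
        simp [he, Algebra.algebraMap_eq_smul_one]
      change ∫ s, (Polynomial.aeval e (Polynomial.monomial n a)) s ∂P
        = ∫ s, (Polynomial.aeval e (Polynomial.monomial n a)) s ∂Q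
      simp only [h2, integral_const_mul, hn]

/-- A complex measure on `[0, ∞)` is determined by its Laplace transform. -/
theorem laplace_injective {ν₁ ν₂ : ComplexMeasure ℝ≥0}
    (h : ∀ x : ℝ, 0 < x → laplace ν₁ x = laplace ν₂ x) : ν₁ = ν₂ := by
  obtain ⟨p, hp, rfl⟩ := exists_eq_sum_ofMeasure ν₁
  obtain ⟨q, hq, rfl⟩ := exists_eq_sum_ofMeasure ν₂
  have hL : ∀ (p : Measure ℝ≥0) [IsFiniteMeasure p] (x : ℝ), 0 < x →
      Integrable (fun s : ℝ≥0 => Real.exp (-(s : ℝ) * x)) p := by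
    intro p _ x hx
    refine Integrable.of_bound (by fun_prop) 1 (Eventually.of_forall fun s => ?_)
    rw [Real.norm_eq_abs, Real.abs_exp, Real.exp_le_one_iff]
    have : 0 ≤ (s : ℝ) * x := mul_nonneg s.2 hx.le
    linarith
  have h' : ∀ x : ℝ, 0 < x → ∑ i, partCoeff i * ((∫ s : ℝ≥0, Real.exp (-(s : ℝ) * x) ∂(p i) : ℝ) : ℂ)
      = ∑ i, partCoeff i * ((∫ s : ℝ≥0, Real.exp (-(s : ℝ) * x) ∂(q i) : ℝ) : ℂ) := by
    intro x hx
    have := h x hx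
    rw [laplace_sum_ofMeasure _ p (by simpa using hx.le),
      laplace_sum_ofMeasure _ q (by simpa using hx.le)] at this
    simpa only [integral_laplace_kernel_ofReal] using this
  -- Moving the negative parts across turns the equality of real parts into one between positive
  -- measures.
  have hre : p 0 + q 1 = q 0 + p 1 := by
    apply measure_ext_of_laplace
    intro x hx
    have := congrArg Complex.re (h' x hx)
    simp [Fin.sum_univ_four, partCoeff] at this
    rw [integral_add_measure (hL _ x hx) (hL _ x hx), integral_add_measure (hL _ x hx) (hL _ x hx)]
    simp only [neg_mul]
    linarith
  have him : p 2 + q 3 = q 2 + p 3 := by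
    apply measure_ext_of_laplace
    intro x hx
    have := congrArg Complex.im (h' x hx)
    simp [Fin.sum_univ_four, partCoeff] at this
    rw [integral_add_measure (hL _ x hx) (hL _ x hx), integral_add_measure (hL _ x hx) (hL _ x hx)]
    simp only [neg_mul]
    linarith
  ext s hs
  have hadd : ∀ (a b c d : Measure ℝ≥0) [IsFiniteMeasure a] [IsFiniteMeasure b] [IsFiniteMeasure c]
      [IsFiniteMeasure d], a + b = c + d → a.real s + b.real s = c.real s + d.real s := by
    intro a b c d _ _ _ _ h
    rw [← measureReal_add_apply, ← measureReal_add_apply, h]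
  have hre' := hadd _ _ _ _ hre
  have him' := hadd _ _ _ _ him
  have hre'' : (((p 0).real s : ℝ) : ℂ) + (q 1).real s = (q 0).real s + (p 1).real s := by
    exact_mod_cast hre'
  have him'' : (((p 2).real s : ℝ) : ℂ) + (q 3).real s = (q 2).real s + (p 3).real s := by
    exact_mod_cast him'
  simp only [Fin.sum_univ_four, add_apply, ofMeasure_apply _ _ hs, partCoeff]

  simp
  linear_combination hre'' + Complex.I * him''

/-- By the identity theorem, all computations with Stieltjes functions can be done on the positive
half-line. -/
theorem IsLaplaceOf.of_eq_ofReal {g : ℂ → ℂ} {ν : ComplexMeasure ℝ≥0}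
    (hg : DifferentiableOn ℂ g rightHalfPlane) (h : ∀ x : ℝ, 0 < x → g x = laplace ν x) :
    IsLaplaceOf g ν :=
  fun _ hz => eqOn_rightHalfPlane_of_eq_ofReal hg (differentiableOn_laplace ν) h hz

theorem ofReal_mem_rightHalfPlane {x : ℝ} (hx : 0 < x) : (x : ℂ) ∈ rightHalfPlane := by
  simpa [rightHalfPlane] using hx

end Laplace

/-! ### Multiplicativity of the Hille-Phillips calculus -/

namespace BoundedC0Semigroup

variable {X : Type*} [NormedAddCommGroup X] [NormedSpace ℂ X] (T : BoundedC0Semigroup X)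

theorem integrable_op_measure (p : Measure ℝ≥0) [IsFiniteMeasure p] (x : X) :
    Integrable (fun s => T.op s x) p := by
  obtain ⟨M, hM⟩ := T.bounded
  refine Integrable.of_bound (T.continuous_op x).aestronglyMeasurable (M * ‖x‖) ?_
  exact Eventually.of_forall fun s => (T.op s).le_of_opNorm_le (hM s) x

variable [CompleteSpace X]

theorem hpOperator_sum_ofMeasure {ι : Type*} [Fintype ι] (c : ι → ℂ)
    (p : ι → Measure ℝ≥0) [∀ i, IsFiniteMeasure (p i)] (x : X) :
    T.hpOperator (∑ i, ofMeasure (c i) (p i)) x = ∑ i, c i • ∫ s, T.op s x ∂(p i) := by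
  rw [hpOperator_apply, integral_sum_ofMeasure c p fun i => T.integrable_op_measure (p i) x]

theorem hpOperator_ofMeasure (c : ℂ) (p : Measure ℝ≥0) [IsFiniteMeasure p] (x : X) :
    T.hpOperator (ofMeasure c p) x = c • ∫ s, T.op s x ∂p := by
  rw [hpOperator_apply, integral_ofMeasure c p (T.integrable_op_measure p x)]

/-- Fubini and the semigroup law: convolution of measures becomes composition of operators. -/
theorem integral_op_conv (p q : Measure ℝ≥0) [IsFiniteMeasure p] [IsFiniteMeasure q] (x : X) :
    ∫ s, T.op s x ∂(p.conv q) = ∫ s, T.op s (∫ t, T.op t x ∂q) ∂p := by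
  obtain ⟨M, hM⟩ := T.bounded
  have hc : Continuous fun w : ℝ≥0 × ℝ≥0 => T.op (w.1 + w.2) x :=
    (T.continuous_op x).comp (continuous_fst.add continuous_snd)
  rw [Measure.conv, integral_map (by fun_prop) (T.continuous_op x).aestronglyMeasurable,
    integral_prod]
  · congr 1 with s
    simp only [T.op_add, mul_apply_eq_comp]
    exact (T.op s).integral_comp_comm (T.integrable_op_measure q x)
  · refine Integrable.of_bound hc.aestronglyMeasurable (M * ‖x‖) ?_
    exact Eventually.of_forall fun w => (T.op _).le_of_opNorm_le (hM _) x

end BoundedC0Semigroup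

theorem integral_laplace_kernel_conv (p q : Measure ℝ≥0) [IsFiniteMeasure p] [IsFiniteMeasure q]
    (z : ℂ) : ∫ s : ℝ≥0, Complex.exp (-((s : ℝ) : ℂ) * z) ∂(p.conv q) =
      (∫ s : ℝ≥0, Complex.exp (-((s : ℝ) : ℂ) * z) ∂p) *
        ∫ s : ℝ≥0, Complex.exp (-((s : ℝ) : ℂ) * z) ∂q := by
  rw [Measure.conv, integral_map (by fun_prop) (continuous_laplace_kernel z).aestronglyMeasurable,
    ← integral_prod_mul]
  congr 1 with w
  rw [← Complex.exp_add]
  push_cast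
  ring_nf

/-- The convolution of two complex measures on `[0, ∞)`, described by its Laplace transform and
its Hille-Phillips operators. -/
theorem exists_conv (ν₁ ν₂ : ComplexMeasure ℝ≥0) : ∃ ν : ComplexMeasure ℝ≥0,
    (∀ z : ℂ, 0 ≤ z.re → laplace ν z = laplace ν₁ z * laplace ν₂ z) ∧
    ∀ {X : Type*} [NormedAddCommGroup X] [NormedSpace ℂ X] [CompleteSpace X]
      (T : BoundedC0Semigroup X), T.hpOperator ν = T.hpOperator ν₁ * T.hpOperator ν₂ := by
  obtain ⟨p, hp, rfl⟩ := exists_eq_sum_ofMeasure ν₁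
  obtain ⟨q, hq, rfl⟩ := exists_eq_sum_ofMeasure ν₂
  refine ⟨∑ w : Fin 4 × Fin 4,
    ofMeasure (partCoeff w.1 * partCoeff w.2) ((p w.1).conv (q w.2)), ?_, ?_⟩
  · intro z hz
    rw [laplace_sum_ofMeasure (fun w : Fin 4 × Fin 4 => partCoeff w.1 * partCoeff w.2)
      (fun w : Fin 4 × Fin 4 => (p w.1).conv (q w.2)) hz, laplace_sum_ofMeasure _ p hz,
      laplace_sum_ofMeasure _ q hz, Finset.sum_mul_sum, Fintype.sum_prod_type]
    refine Finset.sum_congr rfl fun i _ => Finset.sum_congr rfl fun j _ => ?_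
    rw [integral_laplace_kernel_conv]
    ring
  · intro X _ _ _ T
    ext x
    rw [T.hpOperator_sum_ofMeasure (fun w : Fin 4 × Fin 4 => partCoeff w.1 * partCoeff w.2)
      (fun w : Fin 4 × Fin 4 => (p w.1).conv (q w.2)), mul_apply_eq_comp,
      T.hpOperator_sum_ofMeasure _ p, Fintype.sum_prod_type]
    refine Finset.sum_congr rfl fun i _ => ?_
    simp only [T.integral_op_conv, T.hpOperator_sum_ofMeasure _ q, map_sum, map_smul]
    have hj : ∀ j, Integrable (fun s => partCoeff j • T.op s (∫ t, T.op t x ∂q j)) (p i) :=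
      fun j => (T.integrable_op_measure (p i) _).smul (partCoeff j)
    rw [integral_finsetSum _ fun j _ => hj j, Finset.smul_sum]
    refine Finset.sum_congr rfl fun j _ => ?_
    rw [integral_smul, mul_smul]

theorem laplace_sub (ν₁ ν₂ : ComplexMeasure ℝ≥0) {z : ℂ} (hz : 0 ≤ z.re) :
    laplace (ν₁ - ν₂) z = laplace ν₁ z - laplace ν₂ z := by
  have h : ∀ ν : ComplexMeasure ℝ≥0,
      ν.Integrable (fun s : ℝ≥0 => Complex.exp (-((s : ℝ) : ℂ) * z)) :=
    fun ν => integrable_laplace_kernel hz ν.variation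
  exact VectorMeasure.integral_sub_vectorMeasure (h ν₁) (h ν₂)

theorem IsLaplaceOf.eq {g : ℂ → ℂ} {ν₁ ν₂ : ComplexMeasure ℝ≥0} (h₁ : IsLaplaceOf g ν₁)
    (h₂ : IsLaplaceOf g ν₂) : ν₁ = ν₂ :=
  laplace_injective fun x hx => by
    rw [← h₁ x (ofReal_mem_rightHalfPlane hx), ← h₂ x (ofReal_mem_rightHalfPlane hx)]

theorem IsLaplaceOf.sub {g₁ g₂ : ℂ → ℂ} {ν₁ ν₂ : ComplexMeasure ℝ≥0} (h₁ : IsLaplaceOf g₁ ν₁)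
    (h₂ : IsLaplaceOf g₂ ν₂) : IsLaplaceOf (fun z => g₁ z - g₂ z) (ν₁ - ν₂) := fun z hz => by
  rw [laplace_sub _ _ (le_of_lt hz), ← h₁ z hz, ← h₂ z hz]

theorem MemA1.congr {g₁ g₂ : ℂ → ℂ} (h : MemA1 g₁) (hg : Set.EqOn g₁ g₂ rightHalfPlane) :
    MemA1 g₂ := by
  obtain ⟨ν, hν⟩ := h
  exact ⟨ν, fun z hz => by rw [← hg hz, hν z hz]⟩

theorem MemA1.sub {g₁ g₂ : ℂ → ℂ} (h₁ : MemA1 g₁) (h₂ : MemA1 g₂) :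
    MemA1 (fun z => g₁ z - g₂ z) :=
  ⟨_, h₁.choose_spec.sub h₂.choose_spec⟩

theorem MemA1.mul {g₁ g₂ : ℂ → ℂ} (h₁ : MemA1 g₁) (h₂ : MemA1 g₂) :
    MemA1 (fun z => g₁ z * g₂ z) := by
  obtain ⟨ν₁, hν₁⟩ := h₁
  obtain ⟨ν₂, hν₂⟩ := h₂
  obtain ⟨ν, hν, -⟩ := exists_conv.{0} ν₁ ν₂
  exact ⟨ν, fun z hz => by simp only [hν z (le_of_lt hz), hν₁ z hz, hν₂ z hz]⟩

theorem isLaplaceOf_one : IsLaplaceOf (fun _ => 1) (ofMeasure 1 (Measure.dirac 0)) := fun z hz => by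
  rw [laplace_ofMeasure _ _ (le_of_lt hz), integral_dirac]
  simp

theorem memA1_one : MemA1 (fun _ => 1) := ⟨_, isLaplaceOf_one⟩

namespace BoundedC0Semigroup

variable {X : Type*} [NormedAddCommGroup X] [NormedSpace ℂ X] (T : BoundedC0Semigroup X)

theorem hp_eq {g : ℂ → ℂ} {ν : ComplexMeasure ℝ≥0} (h : IsLaplaceOf g ν) :
    T.hp g = T.hpOperator ν := by
  have hg : MemA1 g := ⟨ν, h⟩
  rw [hp, dif_pos hg, hg.choose_spec.eq h]

theorem hp_congr {g₁ g₂ : ℂ → ℂ} (h : MemA1 g₁) (hg : Set.EqOn g₁ g₂ rightHalfPlane) :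
    T.hp g₁ = T.hp g₂ := by
  obtain ⟨ν, hν⟩ := h
  rw [T.hp_eq hν, T.hp_eq (ν := ν) fun z hz => by rw [← hg hz, hν z hz]]

variable [CompleteSpace X]

theorem hp_mul {g₁ g₂ : ℂ → ℂ} (h₁ : MemA1 g₁) (h₂ : MemA1 g₂) :
    T.hp (fun z => g₁ z * g₂ z) = T.hp g₁ * T.hp g₂ := by
  obtain ⟨ν₁, hν₁⟩ := h₁
  obtain ⟨ν₂, hν₂⟩ := h₂
  obtain ⟨ν, hν, hT⟩ := exists_conv ν₁ ν₂
  rw [T.hp_eq hν₁, T.hp_eq hν₂, ← hT T]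
  exact T.hp_eq fun z hz => by simp only [hν z (le_of_lt hz), hν₁ z hz, hν₂ z hz]

theorem hp_comm {g₁ g₂ : ℂ → ℂ} (h₁ : MemA1 g₁) (h₂ : MemA1 g₂) :
    Commute (T.hp g₁) (T.hp g₂) := by
  rw [Commute, SemiconjBy, ← T.hp_mul h₁ h₂, ← T.hp_mul h₂ h₁]
  congr 1 with z
  ring

theorem hp_one : T.hp (fun _ => 1) = 1 := by
  rw [T.hp_eq isLaplaceOf_one]
  ext x
  rw [hpOperator_ofMeasure, integral_dirac, T.op_zero, one_smul]

omit [CompleteSpace X] in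
theorem hp_sub {g₁ g₂ : ℂ → ℂ} (h₁ : MemA1 g₁) (h₂ : MemA1 g₂) :
    T.hp (fun z => g₁ z - g₂ z) = T.hp g₁ - T.hp g₂ := by
  obtain ⟨ν₁, hν₁⟩ := h₁
  obtain ⟨ν₂, hν₂⟩ := h₂
  rw [T.hp_eq hν₁, T.hp_eq hν₂, T.hp_eq (hν₁.sub hν₂)]
  ext x
  rw [sub_apply, hpOperator_apply, hpOperator_apply, hpOperator_apply,
    VectorMeasure.integral_sub_vectorMeasure (T.integrable_op ν₁ x) (T.integrable_op ν₂ x)]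

/-! ### The extended calculus -/

omit [CompleteSpace X] in
-- In this form the graph is visibly closed, and it is the only description of `f(A)` used below.
theorem mem_graph_regularizedBy {e f : ℂ → ℂ} (he : Function.Injective (T.hp e)) (x y : X) :
    (x, y) ∈ (T.regularizedBy e f).graph ↔ T.hp (fun z => e z * f z) x = T.hp e y := by
  have hker : ((T.hp e).toLinearMap.toPMap ⊤).toFun.ker = ⊥ := by
    rw [LinearMap.ker_eq_bot]
    intro a b hab
    exact Subtype.ext (he hab)
  have htop : ∀ (L : X →L[ℂ] X) (a b : X), (a, b) ∈ (L.toLinearMap.toPMap ⊤).graph ↔ L a = b := by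
    intro L a b
    rw [LinearPMap.mem_graph_iff]
    exact ⟨fun ⟨c, hc, hb⟩ => (congrArg L hc.symm).trans hb, fun h => ⟨⟨a, trivial⟩, rfl, h⟩⟩
  have hinv : ∀ a b : X, (a, b) ∈ ((T.hp e).toLinearMap.toPMap ⊤).inverse.graph ↔ T.hp e b = a := by
    intro a b
    rw [LinearPMap.inverse_graph hker, ← htop, Submodule.mem_map]
    constructor
    · rintro ⟨⟨c, d⟩, hcd, h⟩
      obtain ⟨rfl, rfl⟩ : d = a ∧ c = b := by simpa using h
      exact hcd
    · exact fun h => ⟨(b, a), h, rfl⟩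
  rw [regularizedBy, LinearPMap.mem_graph_pcomp]
  simp only [htop, hinv]
  exact ⟨fun ⟨w, hw, hw'⟩ => hw.trans hw'.symm, fun h => ⟨_, rfl, h.symm⟩⟩

theorem extHP_eq_regularizedBy {e f : ℂ → ℂ} (h : T.IsRegularizer e f) :
    T.extHP f = T.regularizedBy e f := by
  have hf : T.IsRegularizable f := ⟨e, h⟩
  rw [extHP, dif_pos hf]
  have h' := hf.choose_spec
  set e' := hf.choose
  apply LinearPMap.eq_of_eq_graph
  ext ⟨x, y⟩
  rw [T.mem_graph_regularizedBy h'.injective, T.mem_graph_regularizedBy h.injective]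
  -- Applying the other, injective, regularizer to each equation brings both to the same equation,
  -- since everything commutes.
  have hswap : T.hp e * T.hp (fun z => e' z * f z) = T.hp e' * T.hp (fun z => e z * f z) := by
    rw [← T.hp_mul h.memA1 h'.memA1_mul, ← T.hp_mul h'.memA1 h.memA1_mul]
    congr 1 with z
    ring
  have hcomm := T.hp_comm h.memA1 h'.memA1
  have hs : T.hp e (T.hp (fun z => e' z * f z) x) = T.hp e' (T.hp (fun z => e z * f z) x) :=
    DFunLike.congr_fun hswap x
  have hc : T.hp e (T.hp e' y) = T.hp e' (T.hp e y) := DFunLike.congr_fun hcomm.eq y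
  rw [← h.injective.eq_iff, hs, hc, h'.injective.eq_iff]

end BoundedC0Semigroup

/-! ### The resolvent of the generator -/

section Exponential

/-- The measure `e^{-ls} ds` on `[0, ∞)`. -/
noncomputable def expDecay (l : ℝ) : Measure ℝ≥0 :=
  ((volume.restrict (Set.Ioi (0 : ℝ))).withDensity
    fun s => ENNReal.ofReal (Real.exp (-l * s))).map Real.toNNReal

theorem isFiniteMeasure_expDecay {l : ℝ} (hl : 0 < l) : IsFiniteMeasure (expDecay l) := by
  have := isFiniteMeasure_withDensity_ofReal (exp_neg_integrableOn_Ioi 0 hl).2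
  rw [expDecay]
  infer_instance

theorem integral_expDecay {E : Type*} [NormedAddCommGroup E] [NormedSpace ℝ E] (l : ℝ)
    {F : ℝ≥0 → E} (hF : Continuous F) :
    ∫ s, F s ∂(expDecay l) = ∫ s in Set.Ioi (0 : ℝ), Real.exp (-l * s) • F s.toNNReal := by
  rw [expDecay, integral_map (by fun_prop) hF.aestronglyMeasurable, integral_withDensity_eq_integral_toReal_smul
    (by fun_prop) (Eventually.of_forall fun s => ENNReal.ofReal_lt_top)]
  congr 1 with s
  rw [ENNReal.toReal_ofReal (Real.exp_nonneg _)]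

theorem integral_laplace_kernel_expDecay {l : ℝ} (hl : 0 < l) {z : ℂ} (hz : 0 ≤ z.re) :
    ∫ s : ℝ≥0, Complex.exp (-((s : ℝ) : ℂ) * z) ∂(expDecay l) = 1 / (l + z) := by
  rw [integral_expDecay l (continuous_laplace_kernel z)]
  have h1 : ∀ s ∈ Set.Ioi (0 : ℝ),
      Real.exp (-l * s) • Complex.exp (-((s.toNNReal : ℝ) : ℂ) * z)
        = Complex.exp (-((l : ℂ) + z) * s) := by
    intro s hs
    rw [Real.coe_toNNReal s (le_of_lt hs), Complex.real_smul, Complex.ofReal_exp,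
      ← Complex.exp_add]
    push_cast
    ring_nf
  have hre : (-((l : ℂ) + z)).re < 0 := by
    simp
    linarith
  rw [setIntegral_congr_fun measurableSet_Ioi h1, integral_exp_mul_complex_Ioi hre]
  simp
  rw [← neg_add_rev, add_comm, neg_div, div_neg]
  simp

theorem isLaplaceOf_inv {l : ℝ} (hl : 0 < l) :
    haveI := isFiniteMeasure_expDecay hl
    IsLaplaceOf (fun z => 1 / (l + z)) (ofMeasure 1 (expDecay l)) := by
  have := isFiniteMeasure_expDecay hl
  intro z hz
  rw [laplace_ofMeasure _ _ (le_of_lt hz), integral_laplace_kernel_expDecay hl (le_of_lt hz),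
    one_mul]

theorem memA1_inv {l : ℝ} (hl : 0 < l) : MemA1 (fun z => 1 / (l + z)) := ⟨_, isLaplaceOf_inv hl⟩

end Exponential

namespace BoundedC0Semigroup

variable {X : Type*} [NormedAddCommGroup X] [NormedSpace ℂ X] (T : BoundedC0Semigroup X)

theorem op_comm (s t : ℝ≥0) : Commute (T.op s) (T.op t) := by
  rw [Commute, SemiconjBy, ← T.op_add, ← T.op_add, add_comm]

/-- The resolvent `(l + A)⁻¹`, where `-A` is the generator. -/
noncomputable def resolvent (l : ℝ) : X →L[ℂ] X := T.hp fun z => 1 / (l + z)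

variable [CompleteSpace X]

theorem resolvent_apply {l : ℝ} (hl : 0 < l) (x : X) :
    T.resolvent l x = ∫ s in Set.Ioi (0 : ℝ), Real.exp (-l * s) • T.op s.toNNReal x := by
  have := isFiniteMeasure_expDecay hl
  rw [resolvent, T.hp_eq (isLaplaceOf_inv hl), hpOperator_ofMeasure, one_smul,
    integral_expDecay l (T.continuous_op x)]

omit [CompleteSpace X] in
theorem integrableOn_resolvent {l : ℝ} (hl : 0 < l) (x : X) (a : ℝ) :
    IntegrableOn (fun s : ℝ => Real.exp (-l * s) • T.op s.toNNReal x) (Set.Ioi a) := by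
  obtain ⟨M, hM⟩ := T.bounded
  refine Integrable.mono' ((exp_neg_integrableOn_Ioi a hl).mul_const (M * ‖x‖)) ?_
    (Eventually.of_forall fun s => ?_)
  · have := T.continuous_op x
    exact Continuous.aestronglyMeasurable (by fun_prop)
  · rw [norm_smul, Real.norm_eq_abs, Real.abs_exp]
    gcongr
    exact (T.op _).le_of_opNorm_le (hM _) x

/-- The shift `s ↦ s + t` in the Laplace integral. The right side depends on `t` only through scalar
factors and a primitive, so its derivative at `0` is immediate. -/
theorem op_resolvent {l : ℝ} (hl : 0 < l) (x : X) (t : ℝ≥0) :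
    T.op t (T.resolvent l x) = Real.exp (l * t) • (T.resolvent l x -
      ∫ s in (0 : ℝ)..t, Real.exp (-l * s) • T.op s.toNNReal x) := by
  have h1 := T.integrableOn_resolvent hl x
  rw [T.resolvent_apply hl, ← ContinuousLinearMap.integral_comp_comm _ (h1 0),
    ← intervalIntegral.integral_Ioi_sub_Ioi (h1 0) t.coe_nonneg, sub_sub_cancel]
  have h2 := (measurePreserving_add_right volume (t : ℝ)).setIntegral_preimage_emb
    (measurableEmbedding_addRight (t : ℝ)) (fun s : ℝ => Real.exp (-l * s) • T.op s.toNNReal x)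
    (Set.Ioi (t : ℝ))
  rw [Set.preimage_add_const_Ioi, sub_self] at h2
  change _ = _ • ∫ s in Set.Ioi (t : ℝ), _
  rw [← h2, ← integral_smul]
  refine setIntegral_congr_fun measurableSet_Ioi fun s hs => ?_
  have hs' : (s + t).toNNReal = t + s.toNNReal := by
    rw [Real.toNNReal_add (le_of_lt hs) t.coe_nonneg, Real.toNNReal_coe, add_comm]
  simp only [hs', T.op_add, mul_apply_eq_comp, ContinuousLinearMap.map_smul_of_tower, smul_smul, ← Real.exp_add]
  congr 2
  ring

theorem resolvent_mem_graph {l : ℝ} (hl : 0 < l) (x : X) :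
    (T.resolvent l x, (l : ℂ) • T.resolvent l x - x) ∈ T.generator.graph := by
  rw [mem_graph_generator]
  set R := T.resolvent l x
  have hG : Continuous fun s : ℝ => Real.exp (-l * s) • T.op s.toNNReal x := by
    have := T.continuous_op x
    fun_prop
  have hint : HasDerivAt (fun t : ℝ => ∫ s in (0 : ℝ)..t, Real.exp (-l * s) • T.op s.toNNReal x) x 0 := by
    have := intervalIntegral.integral_hasDerivAt_right (hG.intervalIntegrable 0 0)
      hG.aestronglyMeasurable.stronglyMeasurableAtFilter hG.continuousAt
    simpa [T.op_zero] using this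
  have hexp : HasDerivAt (fun t : ℝ => Real.exp (l * t)) l 0 := by
    simpa using ((hasDerivAt_id (0 : ℝ)).const_mul l).exp
  have hd : HasDerivAt (fun t : ℝ => Real.exp (l * t) • (R -
      ∫ s in (0 : ℝ)..t, Real.exp (-l * s) • T.op s.toNNReal x)) (l • R - x) 0 := by
    have h := hexp.fun_smul (hint.const_sub R)
    have he : l • R - x = Real.exp (l * 0) • -x + l • (R -
        ∫ s in (0 : ℝ)..0, Real.exp (-l * s) • T.op s.toNNReal x) := by
      simp
      abel
    rwa [← he] at h
  have ht : Tendsto ((↑) : ℝ≥0 → ℝ) (𝓝[>] 0) (𝓝[≠] 0) := by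
    rw [tendsto_nhdsWithin_iff]
    constructor
    · exact (NNReal.continuous_coe.tendsto 0).mono_left nhdsWithin_le_nhds
    · filter_upwards [self_mem_nhdsWithin] with t ht
      exact (NNReal.coe_pos.mpr ht).ne'
  refine ((hasDerivAt_iff_tendsto_slope_zero.mp hd).comp ht).congr fun t => ?_
  simp [R, T.op_resolvent hl x t]

theorem resolvent_comm_op (l : ℝ) (hl : 0 < l) (t : ℝ≥0) (x : X) :
    T.resolvent l (T.op t x) = T.op t (T.resolvent l x) := by
  rw [T.resolvent_apply hl, T.resolvent_apply hl,
    ← ContinuousLinearMap.integral_comp_comm _ (T.integrableOn_resolvent hl x 0)]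
  congr 1 with s
  rw [ContinuousLinearMap.map_smul_of_tower]
  congr 1
  exact DFunLike.congr_fun (T.op_comm s.toNNReal t).eq x

/-- The resolvent commutes with the difference quotients, so `R y` and `l R x - x` are limits of the
same expression. -/
theorem resolvent_apply_of_mem_graph {l : ℝ} (hl : 0 < l) {x y : X}
    (h : (x, y) ∈ T.generator.graph) : T.resolvent l ((l : ℂ) • x - y) = x := by
  have h1 := (T.mem_graph_generator _ _).mp h
  have h2 := ((T.resolvent l).continuous.tendsto y).comp h1
  have h3 := (T.mem_graph_generator _ _).mp (T.resolvent_mem_graph hl x)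
  have h4 : T.resolvent l y = (l : ℂ) • T.resolvent l x - x := by
    refine tendsto_nhds_unique h2 (h3.congr fun t => ?_)
    simp only [Function.comp_apply]
    rw [ContinuousLinearMap.map_smul_of_tower, map_sub, T.resolvent_comm_op l hl]
  rw [map_sub, map_smul, h4]
  abel

theorem exists_norm_resolvent_le : ∃ M : ℝ, 0 ≤ M ∧ ∀ l : ℝ, 0 < l → ∀ x,
    ‖l • T.resolvent l x‖ ≤ M * ‖x‖ := by
  obtain ⟨M, hM⟩ := T.bounded
  refine ⟨M, (norm_nonneg _).trans (hM 0), fun l hl x => ?_⟩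
  have h1 : ‖T.resolvent l x‖ ≤ ∫ s in Set.Ioi (0 : ℝ), Real.exp (-l * s) * (M * ‖x‖) := by
    rw [T.resolvent_apply hl]
    refine norm_integral_le_of_norm_le ((exp_neg_integrableOn_Ioi 0 hl).mul_const _)
      (Eventually.of_forall fun s => ?_)
    rw [norm_smul, Real.norm_eq_abs, Real.abs_exp]
    gcongr
    exact (T.op _).le_of_opNorm_le (hM _) x
  rw [integral_mul_const, integral_exp_mul_Ioi (by linarith)] at h1
  rw [norm_smul, Real.norm_eq_abs, abs_of_pos hl]
  calc l * ‖T.resolvent l x‖ ≤ l * _ := mul_le_mul_of_nonneg_left h1 hl.le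
    _ = M * ‖x‖ := by
      simp
      field_simp

/-- After rescaling, `l R(l) x` is the average of `T(s / l) x` against `e^{-s} ds`; strong
continuity at `0` and dominated convergence finish. -/
theorem tendsto_smul_resolvent {u : ℕ → ℝ} (hu : ∀ n, 0 < u n) (hlim : Tendsto u atTop atTop)
    (x : X) : Tendsto (fun n => u n • T.resolvent (u n) x) atTop (𝓝 x) := by
  obtain ⟨M, hM⟩ := T.bounded
  have h1 : ∀ n, u n • T.resolvent (u n) x
      = ∫ s in Set.Ioi (0 : ℝ), Real.exp (-s) • T.op (s / u n).toNNReal x := by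
    intro n
    have h := integral_comp_mul_left_Ioi
      (fun s : ℝ => Real.exp (-s) • T.op (s / u n).toNNReal x) 0 (hu n)
    rw [mul_zero, eq_inv_smul_iff₀ (hu n).ne'] at h
    rw [← h, T.resolvent_apply (hu n)]
    congr 2 with s
    rw [neg_mul, mul_div_cancel_left₀ _ (hu n).ne']
  have h2 : x = ∫ s in Set.Ioi (0 : ℝ), Real.exp (-s) • x := by
    rw [integral_smul_const, integral_exp_neg_Ioi_zero, one_smul]
  simp only [h1]
  nth_rewrite 2 [h2]
  refine tendsto_integral_of_dominated_convergence (fun s => Real.exp (-s) * (M * ‖x‖))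
    (fun n => ?_) ((integrableOn_exp_neg_Ioi 0).mul_const _)
    (fun n => Eventually.of_forall fun s => ?_) (Eventually.of_forall fun s => ?_)
  · have := T.continuous_op x
    exact Continuous.aestronglyMeasurable (by fun_prop)
  · rw [norm_smul, Real.norm_eq_abs, Real.abs_exp]
    gcongr
    exact (T.op _).le_of_opNorm_le (hM _) x
  · refine Tendsto.const_smul ?_ _
    have h3 : Tendsto (fun n => (s / u n).toNNReal) atTop (𝓝 0) := by
      have := (continuous_real_toNNReal.tendsto 0).comp (hlim.const_div_atTop s)
      simpa [Function.comp_def] using this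
    have h4 := ((T.continuous_op x).tendsto 0).comp h3
    simpa [T.op_zero, Function.comp_def] using h4

/-- If `y = G w` with `G` the generator, then `l R(l) y = l (l R(l) w - w) = O(l)`. The bound on `l
R(l)`, uniform in `l`, extends the limit from the dense set to all `x`. -/
theorem tendsto_smul_resolvent_zero {S : Set X} (hS : Dense S)
    (hSA : ∀ y ∈ S, ∃ x, (x, y) ∈ T.generator.graph)
    {u : ℕ → ℝ} (hu : ∀ n, 0 < u n) (hlim : Tendsto u atTop (𝓝 0)) (x : X) :
    Tendsto (fun n => u n • T.resolvent (u n) x) atTop (𝓝 0) := by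
  obtain ⟨M, hM0, hM⟩ := T.exists_norm_resolvent_le
  have h0 : ∀ y ∈ S, Tendsto (fun n => u n • T.resolvent (u n) y) atTop (𝓝 0) := by
    intro y hy
    obtain ⟨w, hw⟩ := hSA y hy
    have h1 : ∀ n, u n • T.resolvent (u n) y = u n • (u n • T.resolvent (u n) w - w) := by
      intro n
      have := T.resolvent_apply_of_mem_graph (hu n) hw
      rw [map_sub, map_smul, Complex.coe_smul] at this
      congr 1
      nth_rewrite 2 [← this]
      abel
    refine squeeze_zero_norm (a := fun n => u n * (M * ‖w‖ + ‖w‖)) (fun n => ?_) ?_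
    · rw [h1, norm_smul, Real.norm_eq_abs, abs_of_pos (hu n)]
      have := (norm_sub_le (u n • T.resolvent (u n) w) w).trans
        (add_le_add_left (hM _ (hu n) w) ‖w‖)
      exact mul_le_mul_of_nonneg_left this (hu n).le
    · simpa using hlim.mul_const (M * ‖w‖ + ‖w‖)
  rw [Metric.tendsto_atTop]
  intro ε hε
  obtain ⟨y, hyS, hy⟩ := Metric.mem_closure_iff.mp (hS x) (ε / (2 * (M + 1))) (by positivity)
  obtain ⟨N, hN⟩ := Metric.tendsto_atTop.mp (h0 y hyS) (ε / 2) (by positivity)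
  refine ⟨N, fun n hn => ?_⟩
  have h2 := hN n hn
  rw [dist_zero_right] at h2 ⊢
  have h3 := hM (u n) (hu n) (x - y)
  rw [dist_eq_norm, lt_div_iff₀ (by positivity)] at hy
  have h4 : u n • T.resolvent (u n) x = u n • T.resolvent (u n) (x - y)
      + u n • T.resolvent (u n) y := by
    rw [map_sub, smul_sub, sub_add_cancel]
  rw [h4]
  have h5 := norm_add_le (u n • T.resolvent (u n) (x - y)) (u n • T.resolvent (u n) y)
  nlinarith [norm_nonneg (x - y)]

end BoundedC0Semigroup

/-! ### Cores for regularized operators -/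

/-- For `(x, y)` in the graph, commutation keeps `(Q n x, Q n y)` in the graph, its first entry lies
in `S`, and the pairs converge to `(x, y)`. -/
theorem LinearPMap.hasCore_of_approx {X : Type*} [NormedAddCommGroup X] [NormedSpace ℂ X]
    {f : X →ₗ.[ℂ] X} {C E : X →L[ℂ] X} (hf : ∀ x y, (x, y) ∈ f.graph ↔ C x = E y)
    {S : Submodule ℂ X} (hS : ∀ x ∈ S, ∃ y, C x = E y) {Q : ℕ → X →L[ℂ] X}
    (hQC : ∀ n, Commute (Q n) C) (hQE : ∀ n, Commute (Q n) E) (hQS : ∀ n x, Q n x ∈ S)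
    (hQ : ∀ x, Tendsto (fun n => Q n x) atTop (𝓝 x)) : f.HasCore S := by
  have hdom : S ≤ f.domain := fun x hx => by
    obtain ⟨y, hy⟩ := hS x hx
    exact LinearPMap.mem_domain_of_mem_graph ((hf x y).mpr hy)
  have hclosed : f.IsClosed := by
    have : (f.graph : Set (X × X)) = {w | C w.1 = E w.2} := by
      ext ⟨x, y⟩
      exact hf x y
    rw [LinearPMap.IsClosed, this]
    exact isClosed_eq (by fun_prop) (by fun_prop)
  have hle : f.domRestrict S ≤ f := LinearPMap.domRestrict_le
  have hcl : (f.domRestrict S).IsClosable := hclosed.isClosable.leIsClosable hle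
  refine ⟨hdom, LinearPMap.eq_of_eq_graph ?_⟩
  rw [← hcl.graph_closure_eq_closure_graph]
  apply le_antisymm
  · exact Submodule.topologicalClosure_minimal _ (LinearPMap.le_graph_of_le hle) hclosed
  · rintro ⟨x, y⟩ hxy
    have hxy' := (hf x y).mp hxy
    rw [← SetLike.mem_coe, Submodule.topologicalClosure_coe]
    refine mem_closure_of_tendsto ((hQ x).prodMk_nhds (hQ y)) (Eventually.of_forall fun n => ?_)
    have h1 : (Q n x, Q n y) ∈ f.graph := by
      have h2 : C (Q n x) = Q n (C x) := DFunLike.congr_fun (hQC n).symm.eq x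
      have h3 : E (Q n y) = Q n (E y) := DFunLike.congr_fun (hQE n).symm.eq y
      rw [hf, h2, h3, hxy']
    obtain ⟨a, ha, hb⟩ := (LinearPMap.mem_graph_iff _).mp h1
    have ha' : (a : X) = Q n x := ha
    have h4 : (a : X) ∈ (f.domRestrict S).domain := ⟨by rw [ha']; exact hQS n x, a.2⟩
    exact (LinearPMap.mem_graph_iff _).mpr
      ⟨⟨a, h4⟩, ha, (LinearPMap.domRestrict_apply (y := a) rfl).trans hb⟩

namespace BoundedC0Semigroup

variable {X : Type*} [NormedAddCommGroup X] [NormedSpace ℂ X] {T : BoundedC0Semigroup X}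
  {A : X →ₗ.[ℂ] X}

theorem mem_graph_iff_of_generator_eq_neg (hA : T.generator = -A) (x y : X) :
    (x, y) ∈ A.graph ↔ (x, -y) ∈ T.generator.graph := by
  rw [hA, LinearPMap.neg_graph, Submodule.mem_map]
  constructor
  · exact fun h => ⟨(x, y), h, rfl⟩
  · rintro ⟨⟨a, b⟩, hab, h⟩
    obtain ⟨rfl, rfl⟩ : a = x ∧ b = y := by simpa using h
    exact hab

theorem mem_range_pcomp_iff (y : X) :
    y ∈ LinearMap.range (A.pcomp A).toFun ↔ ∃ x w, (x, w) ∈ A.graph ∧ (w, y) ∈ A.graph := by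
  have : y ∈ LinearMap.range (A.pcomp A).toFun ↔ ∃ x, (x, y) ∈ (A.pcomp A).graph := by
    simp only [LinearPMap.mem_graph_iff]
    exact ⟨fun ⟨a, ha⟩ => ⟨a, a, rfl, ha⟩, fun ⟨_, a, _, ha⟩ => ⟨a, ha⟩⟩
  simp only [this, LinearPMap.mem_graph_pcomp]

theorem mem_domain_pcomp_iff (x : X) :
    x ∈ (A.pcomp A).domain ↔ ∃ w y, (x, w) ∈ A.graph ∧ (w, y) ∈ A.graph := by
  rw [LinearPMap.mem_domain_iff]
  simp only [LinearPMap.mem_graph_pcomp]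
  exact exists_comm

variable [CompleteSpace X]

theorem resolvent_mem_graph_neg (hA : T.generator = -A) {l : ℝ} (hl : 0 < l) (x : X) :
    (T.resolvent l x, x - l • T.resolvent l x) ∈ A.graph := by
  rw [mem_graph_iff_of_generator_eq_neg hA, neg_sub]
  exact T.resolvent_mem_graph hl x

theorem resolvent_one_apply_of_mem_graph (hA : T.generator = -A) {x y : X}
    (h : (x, y) ∈ A.graph) : T.resolvent 1 (x + y) = x := by
  have := T.resolvent_apply_of_mem_graph one_pos ((mem_graph_iff_of_generator_eq_neg hA x y).mp h)
  simpa using this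

theorem exists_resolvent_sq_of_mem_graph (hA : T.generator = -A) {x w y : X}
    (hx : (x, w) ∈ A.graph) (hw : (w, y) ∈ A.graph) :
    ∃ v, x = T.resolvent 1 (T.resolvent 1 v) ∧
      y = (1 - T.resolvent 1) ((1 - T.resolvent 1) v) := by
  have h1 := resolvent_one_apply_of_mem_graph hA hx
  have h2 := resolvent_one_apply_of_mem_graph hA (A.graph.add_mem hx hw)
  have h3 := resolvent_one_apply_of_mem_graph hA hw
  have h4 : T.resolvent 1 (x + w + (w + y)) = x + w := h2
  -- This is `(1 + A)² x`; the second identity uses `A (1 + A)⁻¹ = 1 - R(1)`.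
  refine ⟨x + w + (w + y), ?_, ?_⟩
  · rw [h4, h1]
  · have h5 : (1 - T.resolvent 1) (x + w + (w + y)) = w + y := by
      rw [sub_apply, h4]
      simp
    rw [h5, sub_apply, h3]
    simp

theorem resolvent_sq_mem_domain (hA : T.generator = -A) {l : ℝ} (hl : 0 < l) (x : X) :
    T.resolvent l (T.resolvent l x) ∈ (A.pcomp A).domain := by
  rw [mem_domain_pcomp_iff]
  have h := resolvent_mem_graph_neg hA hl
  have h1 := h (T.resolvent l x)
  have h2 := A.graph.sub_mem (h x) (A.graph.smul_mem (l : ℂ) h1)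
  exact ⟨_, _, h1, h2⟩

/-- Since `1 - l R(l) = A R(l)`, the vector is `A² R(l)² x`. -/
theorem one_sub_smul_resolvent_sq_mem_range (hA : T.generator = -A) {l : ℝ} (hl : 0 < l) (x : X) :
    (1 - l • T.resolvent l) ((1 - l • T.resolvent l) x) ∈ LinearMap.range (A.pcomp A).toFun := by
  rw [mem_range_pcomp_iff]
  have h := resolvent_mem_graph_neg hA hl
  have h1 := h (T.resolvent l x)
  have h2 := A.graph.sub_mem (h x) (A.graph.smul_mem (l : ℂ) h1)
  refine ⟨_, _, h1, ?_⟩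
  convert h2 using 1
  simp [smul_sub]

/-- `ran(A²)` is a core for `f(A)` if `z² / (1 + z)²` regularizes `f`. -/
theorem hasCore_range_sq (hA : T.generator = -A)
    (hran : Dense (LinearMap.range A.toFun : Set X)) {e f : ℂ → ℂ} (h : T.IsRegularizer e f)
    (he : T.hp e = (1 - T.resolvent 1) * (1 - T.resolvent 1)) :
    (T.extHP f).HasCore (LinearMap.range (A.pcomp A).toFun) := by
  set C := T.hp fun z => e z * f z
  have hcomm : ∀ l : ℝ, 0 < l → ∀ {g : ℂ → ℂ}, MemA1 g →
      Commute ((1 - l • T.resolvent l) * (1 - l • T.resolvent l)) (T.hp g) := by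
    intro l hl g hg
    have h1 : Commute (1 - l • T.resolvent l) (T.hp g) :=
      (Commute.one_left _).sub_left ((T.hp_comm (memA1_inv hl) hg).smul_left l)
    exact h1.mul_left h1
  have hpos : ∀ n : ℕ, (0 : ℝ) < 1 / ((n : ℝ) + 1) := fun n => by positivity
  rw [T.extHP_eq_regularizedBy h]
  refine LinearPMap.hasCore_of_approx (C := C) (E := T.hp e)
    (T.mem_graph_regularizedBy h.injective) ?_
    (Q := fun n => (1 - (1 / ((n : ℝ) + 1)) • T.resolvent (1 / ((n : ℝ) + 1))) *
      (1 - (1 / ((n : ℝ) + 1)) • T.resolvent (1 / ((n : ℝ) + 1))))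
    (fun n => hcomm _ (hpos n) h.memA1_mul) (fun n => hcomm _ (hpos n) h.memA1)
    (fun n x => one_sub_smul_resolvent_sq_mem_range hA (hpos n) x) ?_
  -- A vector of `ran(A²)` has the form `e(A) v`, and `C` commutes with `e(A)`.
  · intro y hy
    obtain ⟨x, w, hx, hw⟩ := (mem_range_pcomp_iff y).mp hy
    obtain ⟨v, -, rfl⟩ := exists_resolvent_sq_of_mem_graph hA hx hw
    refine ⟨C v, ?_⟩
    have h1 : Commute C (T.hp e) := T.hp_comm h.memA1_mul h.memA1
    have h2 : C (T.hp e v) = T.hp e (C v) := DFunLike.congr_fun h1.eq v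
    rw [← h2, he]
    rfl
  · intro x
    obtain ⟨M, hM0, hM⟩ := T.exists_norm_resolvent_le
    have hz := T.tendsto_smul_resolvent_zero hran (fun y hy => by
      obtain ⟨a, ha⟩ := hy
      refine ⟨-(a : X), ?_⟩
      have h1 : ((a : X), y) ∈ A.graph := (LinearPMap.mem_graph_iff _).mpr ⟨a, rfl, ha⟩
      have h2 := (mem_graph_iff_of_generator_eq_neg hA _ _).mp h1
      simpa using T.generator.graph.neg_mem h2) hpos tendsto_one_div_add_atTop_nhds_zero_nat x
    rw [← tendsto_sub_nhds_zero_iff]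
    have hz' := hz.norm.const_mul (2 + M)
    rw [norm_zero, mul_zero] at hz'
    refine squeeze_zero_norm (fun n => ?_) hz'
    set l : ℝ := 1 / ((n : ℝ) + 1)
    -- With `P = l R(l)` this is `(1 - P)² - 1 = P² - 2 P`, of norm at most `(2 + M) ‖P x‖` at `x`.
    have h1 : ((1 - l • T.resolvent l) * (1 - l • T.resolvent l)) x - x
        = l • T.resolvent l (l • T.resolvent l x) - (2 : ℝ) • (l • T.resolvent l x) := by
      simp [two_smul, smul_sub]
      abel
    rw [h1]
    have h2 := hM l (hpos n) (l • T.resolvent l x)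
    have h3 := norm_sub_le (l • T.resolvent l (l • T.resolvent l x))
      ((2 : ℝ) • (l • T.resolvent l x))
    rw [norm_smul (2 : ℝ), Real.norm_ofNat] at h3
    linarith

/-- `dom(A²)` is a core for `f(A)` if `1 / (1 + z)²` regularizes `f`. -/
theorem hasCore_domain_sq (hA : T.generator = -A) {e f : ℂ → ℂ} (h : T.IsRegularizer e f)
    (he : T.hp e = T.resolvent 1 * T.resolvent 1) :
    (T.extHP f).HasCore (A.pcomp A).domain := by
  set C := T.hp fun z => e z * f z
  have hcomm : ∀ l : ℝ, 0 < l → ∀ {g : ℂ → ℂ}, MemA1 g →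
      Commute ((l • T.resolvent l) * (l • T.resolvent l)) (T.hp g) := by
    intro l hl g hg
    have h1 : Commute (l • T.resolvent l) (T.hp g) := (T.hp_comm (memA1_inv hl) hg).smul_left l
    exact h1.mul_left h1
  have hpos : ∀ n : ℕ, (0 : ℝ) < (n : ℝ) + 1 := fun n => by positivity
  rw [T.extHP_eq_regularizedBy h]
  refine LinearPMap.hasCore_of_approx (C := C) (E := T.hp e)
    (T.mem_graph_regularizedBy h.injective) ?_
    (Q := fun n => (((n : ℝ) + 1) • T.resolvent ((n : ℝ) + 1)) *
      (((n : ℝ) + 1) • T.resolvent ((n : ℝ) + 1)))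
    (fun n => hcomm _ (hpos n) h.memA1_mul) (fun n => hcomm _ (hpos n) h.memA1)
    (fun n x => ?_) ?_
  · intro x hx
    obtain ⟨w, y, hx, hw⟩ := (mem_domain_pcomp_iff x).mp hx
    obtain ⟨v, rfl, -⟩ := exists_resolvent_sq_of_mem_graph hA hx hw
    refine ⟨C v, ?_⟩
    have h1 : Commute C (T.hp e) := T.hp_comm h.memA1_mul h.memA1
    have h2 : C (T.hp e v) = T.hp e (C v) := DFunLike.congr_fun h1.eq v
    rw [← h2, he]
    rfl
  · have h1 := Submodule.smul_of_tower_mem (A.pcomp A).domain (((n : ℝ) + 1) * ((n : ℝ) + 1))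
      (resolvent_sq_mem_domain hA (hpos n) x)
    convert h1 using 1
    simp [mul_smul]
  · intro x
    obtain ⟨M, hM0, hM⟩ := T.exists_norm_resolvent_le
    have hz := tendsto_sub_nhds_zero_iff.mpr (T.tendsto_smul_resolvent hpos
      (tendsto_atTop_add_const_right _ 1 tendsto_natCast_atTop_atTop) x)
    rw [← tendsto_sub_nhds_zero_iff]
    have hz' := hz.norm.const_mul (1 + M)
    rw [norm_zero, mul_zero] at hz'
    refine squeeze_zero_norm (fun n => ?_) hz'
    set l : ℝ := (n : ℝ) + 1
    -- With `P = l R(l)` this is `P² - 1 = P (P - 1) + (P - 1)`.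
    have h1 : ((l • T.resolvent l) * (l • T.resolvent l)) x - x
        = l • T.resolvent l (l • T.resolvent l x - x) + (l • T.resolvent l x - x) := by
      simp [smul_sub]
    rw [h1]
    have h2 := hM l (hpos n) (l • T.resolvent l x - x)
    have h3 := norm_add_le (l • T.resolvent l (l • T.resolvent l x - x))
      (l • T.resolvent l x - x)
    linarith

/-! ### Injectivity of the regularizers -/

theorem injective_resolvent {l : ℝ} (hl : 0 < l) : Function.Injective (T.resolvent l) := by
  rw [injective_iff_map_eq_zero]
  intro x hx
  have h := T.resolvent_mem_graph hl x
  rw [hx, smul_zero, zero_sub] at h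
  simpa using LinearPMap.graph_fst_eq_zero_snd _ h rfl

/-- `R(1) x = x` means `A x = 0`, so `l R(l) x = x` for every `l > 0`; as `l → 0` the left side
vanishes because `A` has dense range. -/
theorem injective_one_sub_resolvent (hA : T.generator = -A)
    (hran : Dense (LinearMap.range A.toFun : Set X)) :
    Function.Injective (1 - T.resolvent 1 : X →L[ℂ] X) := by
  rw [injective_iff_map_eq_zero]
  intro x hx
  have hx' : T.resolvent 1 x = x := (sub_eq_zero.mp hx).symm
  have h0 : (x, (0 : X)) ∈ T.generator.graph := by
    have h := T.resolvent_mem_graph one_pos x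
    rwa [hx', Complex.ofReal_one, one_smul, sub_self] at h
  have hpos : ∀ n : ℕ, (0 : ℝ) < 1 / ((n : ℝ) + 1) := fun n => by positivity
  have hz := T.tendsto_smul_resolvent_zero hran (fun y hy => by
    obtain ⟨a, ha⟩ := hy
    refine ⟨-(a : X), ?_⟩
    have h1 : ((a : X), y) ∈ A.graph := (LinearPMap.mem_graph_iff _).mpr ⟨a, rfl, ha⟩
    have h2 := (mem_graph_iff_of_generator_eq_neg hA _ _).mp h1
    simpa using T.generator.graph.neg_mem h2) hpos tendsto_one_div_add_atTop_nhds_zero_nat x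
  refine tendsto_nhds_unique (tendsto_const_nhds.congr fun n => ?_) hz
  have := T.resolvent_apply_of_mem_graph (hpos n) h0
  rw [sub_zero, map_smul, Complex.coe_smul] at this
  exact this.symm

/-! ### The regularizers -/

theorem memA1_one_div_sq : MemA1 (fun z : ℂ => 1 / (1 + z) ^ 2) := by
  refine ((memA1_inv one_pos).mul (memA1_inv one_pos)).congr fun z _ => ?_
  simp [sq]

theorem hp_one_div_sq :
    T.hp (fun z : ℂ => 1 / (1 + z) ^ 2) = T.resolvent 1 * T.resolvent 1 := by
  rw [resolvent, ← T.hp_mul (memA1_inv one_pos) (memA1_inv one_pos)]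
  congr 1 with z
  simp [sq]

theorem one_sub_inv_sq {z : ℂ} (hz : z ∈ rightHalfPlane) :
    (1 - 1 / (((1 : ℝ) : ℂ) + z)) * (1 - 1 / (((1 : ℝ) : ℂ) + z)) = z ^ 2 / (1 + z) ^ 2 := by
  have h1 : 1 + z ≠ 0 := fun h => by
    have := congrArg Complex.re h
    have hz' : 0 < z.re := hz
    simp at this
    linarith
  rw [Complex.ofReal_one]
  field_simp
  ring

theorem memA1_sq_div_sq : MemA1 (fun z : ℂ => z ^ 2 / (1 + z) ^ 2) :=
  ((memA1_one.sub (memA1_inv one_pos)).mul (memA1_one.sub (memA1_inv one_pos))).congr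
    fun _ hz => one_sub_inv_sq hz

theorem hp_sq_div_sq : T.hp (fun z : ℂ => z ^ 2 / (1 + z) ^ 2)
    = (1 - T.resolvent 1) * (1 - T.resolvent 1) := by
  have h := memA1_one.sub (memA1_inv one_pos)
  rw [← T.hp_congr (h.mul h) fun _ hz => one_sub_inv_sq hz, T.hp_mul h h,
    T.hp_sub memA1_one (memA1_inv one_pos), T.hp_one, resolvent]

end BoundedC0Semigroup

/-! ### Reciprocals of Stieltjes functions -/

section Reciprocal

/-- The reciprocal of a discrete Stieltjes function, through the eigenvalues of a rank-one
perturbation of a diagonal matrix. -/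
theorem exists_discrete_reciprocal {n : ℕ} {a : ℝ} (ha : 0 < a) {c τ : Fin n → ℝ}
    (hc : ∀ i, 0 ≤ c i) (hτ : ∀ i, 0 < τ i) :
    ∃ (b : ℝ) (l d : Fin n → ℝ), 0 ≤ b ∧ (∀ j, 0 < l j) ∧ (∀ j, 0 ≤ d j) ∧
      ∀ x : ℝ, 0 < x → (a + ∑ i, c i / (x + τ i)) * (b + ∑ j, d j * (x / (x + l j))) = 1 := by
  set v : Fin n → ℝ := fun i => √(c i)
  have hv : ∀ i, v i * v i = c i := fun i => Real.mul_self_sqrt (hc i)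
  -- With `D = diag τ`, the given function is `g(x) = a + vᵀ (x + D)⁻¹ v`, and `M = D + a⁻¹ v vᵀ`.
  set M : Matrix (Fin n) (Fin n) ℝ := Matrix.diagonal τ + a⁻¹ • Matrix.vecMulVec v v
  have hM : M.PosDef := by
    refine (Matrix.PosDef.diagonal hτ).add_posSemidef (Matrix.PosSemidef.smul ?_ (by positivity))
    simpa using Matrix.posSemidef_vecMulVec_self_star v
  have hH := hM.isHermitian
  set l := hH.eigenvalues
  have hl : ∀ j, 0 < l j := hM.eigenvalues_pos
  set u : Fin n → Fin n → ℝ := fun j => ⇑(hH.eigenvectorBasis j)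
  have hu : ∀ j, M.mulVec (u j) = l j • u j := fun j => hH.mulVec_eigenvectorBasis j
  have hparseval : ∀ y w : Fin n → ℝ, ∑ j, (u j ⬝ᵥ y) * (u j ⬝ᵥ w) = y ⬝ᵥ w := by
    intro y w
    have := hH.eigenvectorBasis.sum_inner_mul_inner (WithLp.toLp 2 y) (WithLp.toLp 2 w)
    simpa [PiLp.inner_apply, dotProduct, u, mul_comm] using this
  have hMt : M.transpose = M := by simpa [Matrix.IsHermitian] using hH
  set g : ℝ → ℝ := fun x => a + ∑ i, c i / (x + τ i)
  -- Sherman–Morrison, `1 / g(x) = 1 / a - a⁻² vᵀ (x + M)⁻¹ v`, expanded in eigenvectors of `M`. The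
  -- case `x = 0` is included to evaluate `b`.
  have key : ∀ x : ℝ, 0 ≤ x → g x * (1 / a - ∑ j, (u j ⬝ᵥ v) ^ 2 / a ^ 2 / (x + l j)) = 1 := by
    intro x hx
    set y : Fin n → ℝ := fun i => v i / (x + τ i)
    have hvy : v ⬝ᵥ y = g x - a := by
      simp only [dotProduct, y, g, add_sub_cancel_left, ← mul_div_assoc, hv]
    have hMy : ∀ i, M.mulVec y i = τ i * y i + a⁻¹ * (v i * (g x - a)) := by
      intro i
      rw [← hvy]
      simp [M, Matrix.add_mulVec, Matrix.mulVec_diagonal, Matrix.smul_mulVec,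
        Matrix.vecMulVec_mulVec]
      left
      ring
    have hsum : x • y + M.mulVec y = (g x / a) • v := by
      ext i
      have h1 : x + τ i ≠ 0 := (add_pos_of_nonneg_of_pos hx (hτ i)).ne'
      have h2 : (x + τ i) * y i = v i := mul_div_cancel₀ _ h1
      simp only [Pi.add_apply, Pi.smul_apply, smul_eq_mul, hMy]
      field_simp
      linear_combination a * h2
    have hj : ∀ j, u j ⬝ᵥ y = g x / a * (u j ⬝ᵥ v) / (x + l j) := by
      intro j
      have h1 := congrArg (fun w => u j ⬝ᵥ w) hsum
      simp only [dotProduct_add, dotProduct_smul, smul_eq_mul] at h1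
      rw [Matrix.dotProduct_mulVec, ← Matrix.mulVec_transpose, hMt, hu, smul_dotProduct,
        smul_eq_mul] at h1
      rw [eq_div_iff (add_pos_of_nonneg_of_pos hx (hl j)).ne']
      linear_combination h1
    have h3 : g x - a = g x / a * ∑ j, (u j ⬝ᵥ v) ^ 2 / (x + l j) := by
      rw [← hvy, ← hparseval, Finset.mul_sum]
      refine Finset.sum_congr rfl fun j _ => ?_
      rw [hj]
      ring
    have h4 : ∑ j, (u j ⬝ᵥ v) ^ 2 / a ^ 2 / (x + l j)
        = (∑ j, (u j ⬝ᵥ v) ^ 2 / (x + l j)) / a ^ 2 := by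
      rw [Finset.sum_div]
      exact Finset.sum_congr rfl fun j _ => by ring
    rw [h4]
    field_simp
    field_simp at h3
    linear_combination h3
  have hg0 : 0 < g 0 := by
    have : 0 ≤ ∑ i, c i / (0 + τ i) :=
      Finset.sum_nonneg fun i _ => div_nonneg (hc i) (by linarith [hτ i])
    simp only [g]
    linarith
  -- Here `b = 1 / g(0)`, and the rest comes from `1 / l - 1 / (x + l) = x / (l (x + l))`.
  refine ⟨1 / a - ∑ j, (u j ⬝ᵥ v) ^ 2 / a ^ 2 / (0 + l j), l,
    fun j => (u j ⬝ᵥ v) ^ 2 / a ^ 2 / l j, ?_, hl, fun j => ?_, fun x hx => ?_⟩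
  · exact (pos_of_mul_pos_right (by rw [key 0 le_rfl]; exact one_pos) hg0.le).le
  · have := hl j
    positivity
  · refine Eq.trans ?_ (key x hx.le)
    congr 1
    rw [sub_add, ← Finset.sum_sub_distrib]
    congr 1
    refine Finset.sum_congr rfl fun j _ => ?_
    have h1 := hl j
    have h2 : x + l j ≠ 0 := by linarith
    field_simp
    ring

/-- The kernel `1 / (t x + 1 - t)`, `t ∈ [0, 1]`, of Stieltjes functions. -/
noncomputable def stieltjesKernel (x : ℝ) (t : unitInterval) : ℝ := (t * x + (1 - t))⁻¹

theorem stieltjesKernel_denom_ge (x : ℝ) (t : unitInterval) :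
    min x 1 ≤ t * x + (1 - t) := by
  have h0 := t.2.1
  have h1 := t.2.2
  have h2 := min_le_left x 1
  have h3 := min_le_right x 1
  nlinarith

theorem stieltjesKernel_pos {x : ℝ} (hx : 0 < x) (t : unitInterval) : 0 < stieltjesKernel x t :=
  inv_pos.mpr ((lt_min hx one_pos).trans_le (stieltjesKernel_denom_ge x t))

theorem continuous_stieltjesKernel {x : ℝ} (hx : 0 < x) : Continuous (stieltjesKernel x) := by
  refine Continuous.inv₀ (by fun_prop) fun t => ?_
  exact ((lt_min hx one_pos).trans_le (stieltjesKernel_denom_ge x t)).ne'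

theorem stieltjesKernel_le {x : ℝ} (hx : 0 < x) (t : unitInterval) :
    stieltjesKernel x t ≤ (min x 1)⁻¹ :=
  inv_anti₀ (lt_min hx one_pos) (stieltjesKernel_denom_ge x t)

theorem integrable_stieltjesKernel {x : ℝ} (hx : 0 < x) (ρ : Measure unitInterval)
    [IsFiniteMeasure ρ] : Integrable (stieltjesKernel x) ρ :=
  Integrable.of_bound (continuous_stieltjesKernel hx).aestronglyMeasurable (min x 1)⁻¹
    (Eventually.of_forall fun t => by
      rw [Real.norm_of_nonneg (stieltjesKernel_pos hx t).le]
      exact stieltjesKernel_le hx t)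

theorem stieltjesKernel_one (t : unitInterval) : stieltjesKernel 1 t = 1 := by
  simp [stieltjesKernel]

/-- The point `1 / (1 + τ)` of the unit interval. -/
noncomputable def unitPoint (τ : ℝ≥0) : unitInterval :=
  ⟨1 / (1 + τ), by positivity, by rw [div_le_one (by positivity)]; simp⟩

theorem stieltjesKernel_unitPoint {x : ℝ} (hx : 0 < x) (τ : ℝ≥0) :
    stieltjesKernel x (unitPoint τ) = (1 + τ) / (x + τ) := by
  have h1 : (0 : ℝ) < 1 + τ := by positivity
  have h2 : (0 : ℝ) < x + τ := by positivity
  rw [stieltjesKernel, unitPoint, inv_eq_one_div]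
  have : (1 : ℝ) / (1 + τ) * x + (1 - 1 / (1 + τ)) = (x + τ) / (1 + τ) := by
    field_simp
    ring
  simp only [this, one_div_div]

theorem exists_measure_discrete_reciprocal {n : ℕ} {a : ℝ} (ha : 0 < a) {w : Fin n → ℝ}
    {t : Fin n → unitInterval} (hw : ∀ i, 0 ≤ w i) (ht : ∀ i, 0 < (t i : ℝ) ∧ (t i : ℝ) < 1) :
    ∃ (σ : Measure unitInterval) (_ : IsFiniteMeasure σ), ∀ x : ℝ, 0 < x →
      (a + ∑ i, w i * stieltjesKernel x (t i)) * (x * ∫ s, stieltjesKernel x s ∂σ) = 1 := by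
  obtain ⟨b, l, d, hb, hl, hd, h⟩ := exists_discrete_reciprocal ha (c := fun i => w i / t i)
    (τ := fun i => (1 - t i) / t i) (fun i => div_nonneg (hw i) (ht i).1.le)
    (fun i => div_pos (by linarith [(ht i).2]) (ht i).1)
  -- At `t = 1` the kernel is `1 / x`, which yields the constant `b` after multiplication by `x`;
  -- the point `1 / (1 + l)` yields `(1 + l) x / (x + l)`.
  refine ⟨ENNReal.ofReal b • Measure.dirac 1 + ∑ j, ENNReal.ofReal (d j / (1 + l j)) •
    Measure.dirac (unitPoint (l j).toNNReal), ?_, fun x hx => ?_⟩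
  · have h1 := Measure.smul_finite (Measure.dirac (1 : unitInterval)) (c := ENNReal.ofReal b)
      ENNReal.ofReal_ne_top
    have h2 : ∀ j, IsFiniteMeasure (ENNReal.ofReal (d j / (1 + l j)) •
        Measure.dirac (unitPoint (l j).toNNReal)) := fun j =>
      Measure.smul_finite _ ENNReal.ofReal_ne_top
    infer_instance
  · have h2 : ∀ j, Integrable (stieltjesKernel x) (ENNReal.ofReal (d j / (1 + l j)) •
        Measure.dirac (unitPoint (l j).toNNReal)) := fun j =>
      (integrable_stieltjesKernel hx _).smul_measure ENNReal.ofReal_ne_top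
    rw [integral_add_measure ((integrable_stieltjesKernel hx _).smul_measure ENNReal.ofReal_ne_top)
      (integrable_finsetSum_measure.mpr fun j _ => h2 j),
      integral_finsetSum_measure fun j _ => h2 j]
    simp only [integral_smul_measure, integral_dirac]
    refine Eq.trans ?_ (h x hx)
    congr 1
    · congr 1
      refine Finset.sum_congr rfl fun i _ => ?_
      have h1 := (ht i).1
      have h3 : 0 < (t i : ℝ) * x + (1 - t i) := by nlinarith [(ht i).2]
      rw [stieltjesKernel]
      have : x + (1 - (t i : ℝ)) / t i = (t i * x + (1 - t i)) / t i := by field_simp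
      rw [this]
      field_simp
    · rw [mul_add, ENNReal.toReal_ofReal hb, smul_eq_mul, Finset.mul_sum]
      congr 1
      · simp [stieltjesKernel]
        field_simp
      · refine Finset.sum_congr rfl fun j _ => ?_
        have h1 := hl j
        rw [ENNReal.toReal_ofReal (div_nonneg (hd j) (by linarith)), stieltjesKernel_unitPoint hx,
          Real.coe_toNNReal _ h1.le, smul_eq_mul]
        field_simp

end Reciprocal

/-! ### Reciprocals for general measures, by discretization and weak compactness. -/

section ReciprocalLimit

theorem exists_floor_discretization (ρ : Measure unitInterval) [IsProbabilityMeasure ρ] :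
    ∃ g : ℕ → ℝ → ℝ, (∀ x : ℝ, 0 < x →
      Tendsto (fun n => g n x) atTop (𝓝 (∫ t, stieltjesKernel x t ∂ρ))) ∧
      ∀ n, ∃ σ : ProbabilityMeasure unitInterval, ∀ x : ℝ, 0 < x →
        g n x * (x * ∫ s, stieltjesKernel x s ∂(σ : Measure unitInterval)) = 1 := by
  have hθ : ∀ (n : ℕ) (k : Fin (n + 1)), ((k : ℝ) + 1) / (n + 2) ∈ unitInterval := fun n k => by
    have h1 : (k : ℝ) ≤ n := by exact_mod_cast Nat.lt_succ_iff.mp k.2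
    exact ⟨by positivity, by rw [div_le_one (by positivity)]; linarith⟩
  -- The nodes avoid `0` and `1`, so that `τ = (1 - t) / t` is finite and positive.
  set θ : (n : ℕ) → Fin (n + 1) → unitInterval := fun n k => ⟨((k : ℝ) + 1) / (n + 2), hθ n k⟩
  have hκ : ∀ (n : ℕ) (t : unitInterval), ⌊n * (t : ℝ)⌋₊ < n + 1 := fun n t => by
    have h1 : (⌊n * (t : ℝ)⌋₊ : ℝ) ≤ n * t := Nat.floor_le (mul_nonneg n.cast_nonneg t.2.1)
    have h2 : (n : ℝ) * t ≤ n := mul_le_of_le_one_right n.cast_nonneg t.2.2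
    exact Nat.lt_succ_iff.mpr (by exact_mod_cast h1.trans h2)
  set κ : (n : ℕ) → unitInterval → Fin (n + 1) := fun n t => ⟨⌊n * (t : ℝ)⌋₊, hκ n t⟩
  have hκm : ∀ n, Measurable (κ n) := fun n => by
    refine measurable_to_countable' fun k => ?_
    have : κ n ⁻¹' {k} = (fun t : unitInterval => ⌊n * (t : ℝ)⌋₊) ⁻¹' {(k : ℕ)} := by
      ext t
      simp [κ, Fin.ext_iff]
    rw [this]
    have hm : Measurable fun t : unitInterval => ⌊n * (t : ℝ)⌋₊ :=
      Nat.measurable_floor.comp (by fun_prop)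
    exact hm (measurableSet_singleton _)
  have hlim : ∀ t : unitInterval, Tendsto (fun n => θ n (κ n t)) atTop (𝓝 t) := fun t => by
    rw [tendsto_subtype_rng]
    have h1 : Tendsto (fun n : ℕ => 2 / ((n : ℝ) + 2)) atTop (𝓝 0) :=
      (tendsto_atTop_add_const_right _ 2 tendsto_natCast_atTop_atTop).const_div_atTop 2
    rw [← tendsto_sub_nhds_zero_iff]
    refine squeeze_zero_norm (fun n => ?_) h1
    have h2 : (⌊n * (t : ℝ)⌋₊ : ℝ) ≤ n * t := Nat.floor_le (mul_nonneg n.cast_nonneg t.2.1)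
    have h3 : n * (t : ℝ) < ⌊n * (t : ℝ)⌋₊ + 1 := Nat.lt_floor_add_one _
    have h4 : ((θ n (κ n t) : unitInterval) : ℝ) = (⌊n * (t : ℝ)⌋₊ + 1) / ((n : ℝ) + 2) := rfl
    have h5 : (0 : ℝ) < (n : ℝ) + 2 := by positivity
    have h6 := t.2.1
    have h7 := t.2.2
    rw [h4, Real.norm_eq_abs, div_sub' h5.ne', abs_div, abs_of_pos h5]
    gcongr
    rw [abs_le]
    constructor <;> linarith
  -- Mixing in the constant `1` with weight `ε n` provides the positive `a` of the discrete case and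
  -- keeps the value at `x = 1` equal to `1`.
  set ε : ℕ → ℝ := fun n => 1 / ((n : ℝ) + 1)
  have hε : ∀ n, 0 < ε n ∧ ε n ≤ 1 := fun n =>
    ⟨by positivity, by rw [div_le_one (by positivity)]; simp⟩
  refine ⟨fun n x => ε n + (1 - ε n) * ∫ t, stieltjesKernel x (θ n (κ n t)) ∂ρ,
    fun x hx => ?_, fun n => ?_⟩
  · have h1 : Tendsto ε atTop (𝓝 0) := tendsto_one_div_add_atTop_nhds_zero_nat
    have h2 : Tendsto (fun n => ∫ t, stieltjesKernel x (θ n (κ n t)) ∂ρ) atTop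
        (𝓝 (∫ t, stieltjesKernel x t ∂ρ)) := by
      refine tendsto_integral_of_dominated_convergence (fun _ => (min x 1)⁻¹) (fun n => ?_)
        (integrable_const _) (fun n => Eventually.of_forall fun t => ?_)
        (Eventually.of_forall fun t => ?_)
      · have hm : Measurable (θ n) := measurable_of_countable _
        exact ((continuous_stieltjesKernel hx).measurable.comp
          (hm.comp (hκm n))).aestronglyMeasurable
      · rw [Real.norm_of_nonneg (stieltjesKernel_pos hx _).le]
        exact stieltjesKernel_le hx _
      · exact ((continuous_stieltjesKernel hx).tendsto t).comp (hlim t)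
    simpa using h1.add ((h1.const_sub 1).mul h2)
  · have h1 : ∀ x : ℝ, ∫ t, stieltjesKernel x (θ n (κ n t)) ∂ρ
        = ∑ k, (ρ.map (κ n)).real {k} * stieltjesKernel x (θ n k) := fun x => by
      have hm : StronglyMeasurable fun k => stieltjesKernel x (θ n k) :=
        (measurable_of_countable _).stronglyMeasurable
      have : IsFiniteMeasure (ρ.map (κ n)) := inferInstance
      rw [← integral_map (hκm n).aemeasurable hm.aestronglyMeasurable,
        integral_fintype Integrable.of_finite]
      rfl
    obtain ⟨σ, hσf, hσ⟩ := exists_measure_discrete_reciprocal (hε n).1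
      (w := fun k => (1 - ε n) * (ρ.map (κ n)).real {k}) (t := θ n)
      (fun k => mul_nonneg (by linarith [(hε n).2]) measureReal_nonneg) (fun k => by
        have h2 : (k : ℝ) ≤ n := by exact_mod_cast Nat.lt_succ_iff.mp k.2
        constructor
        · change 0 < ((k : ℝ) + 1) / (n + 2)
          positivity
        · change ((k : ℝ) + 1) / (n + 2) < 1
          rw [div_lt_one (by positivity)]
          linarith)
    have h2 : ∀ x : ℝ, 0 < x → (ε n + (1 - ε n) * ∫ t, stieltjesKernel x (θ n (κ n t)) ∂ρ) *
        (x * ∫ s, stieltjesKernel x s ∂σ) = 1 := fun x hx => by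
      refine Eq.trans ?_ (hσ x hx)
      rw [h1, Finset.mul_sum]
      simp only [mul_assoc]
    -- The kernel is `1` at `x = 1`, so the identity there reads off the total mass.
    have hprob : IsProbabilityMeasure σ := by
      have h3 := h2 1 one_pos
      simp only [stieltjesKernel_one, integral_const, probReal_univ, smul_eq_mul, mul_one,
        one_mul, add_sub_cancel] at h3
      rw [Measure.real, ENNReal.toReal_eq_one_iff] at h3
      exact ⟨h3⟩
    exact ⟨⟨σ, hprob⟩, h2⟩

theorem exists_probabilityMeasure_reciprocal (ρ : Measure unitInterval) [IsProbabilityMeasure ρ] :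
    ∃ σ : ProbabilityMeasure unitInterval, ∀ x : ℝ, 0 < x →
      (∫ t, stieltjesKernel x t ∂ρ) *
        (x * ∫ s, stieltjesKernel x s ∂(σ : Measure unitInterval)) = 1 := by
  obtain ⟨g, hg, h⟩ := exists_floor_discretization ρ
  choose σ hσ using h
  -- Compactness of the probability measures on `[0, 1]` gives a limit along an ultrafilter, which
  -- serves all `x` at once.
  set U : Ultrafilter (ProbabilityMeasure unitInterval) := (hyperfilter ℕ).map σ
  obtain ⟨s, -, hs⟩ := isCompact_univ.ultrafilter_le_nhds U (by simp)
  have hs' : Tendsto σ (hyperfilter ℕ) (𝓝 s) := hs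
  refine ⟨s, fun x hx => ?_⟩
  have h1 := (hg x hx).mono_left Nat.hyperfilter_le_atTop
  let φ : BoundedContinuousFunction unitInterval ℝ :=
    BoundedContinuousFunction.mkOfCompact ⟨stieltjesKernel x, continuous_stieltjesKernel hx⟩
  have h2 := ProbabilityMeasure.tendsto_iff_forall_integral_tendsto.mp hs' φ
  have h3 := h1.mul (h2.const_mul x)
  exact (tendsto_nhds_unique (tendsto_const_nhds.congr fun n => (hσ n x hx).symm) h3).symm

/-- The reciprocal of a non-zero Stieltjes function. -/
theorem exists_measure_reciprocal (ρ : Measure unitInterval) [IsFiniteMeasure ρ] (hρ : ρ ≠ 0) :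
    ∃ (σ : Measure unitInterval) (_ : IsFiniteMeasure σ), ∀ x : ℝ, 0 < x →
      (∫ t, stieltjesKernel x t ∂ρ) * (x * ∫ s, stieltjesKernel x s ∂σ) = 1 := by
  have : NeZero ρ := ⟨hρ⟩
  obtain ⟨σ, hσ⟩ := exists_probabilityMeasure_reciprocal ((ρ Set.univ)⁻¹ • ρ)
  have h0 : ρ Set.univ ≠ 0 := by simpa using hρ
  -- Normalizing `ρ` divides the function by its mass, so the reciprocal is divided by that mass
  -- too.
  refine ⟨(ρ Set.univ)⁻¹ • (σ : Measure unitInterval),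
    Measure.smul_finite _ (ENNReal.inv_ne_top.mpr h0), fun x hx => ?_⟩
  rw [← hσ x hx, integral_smul_measure, integral_smul_measure, smul_eq_mul, smul_eq_mul]
  ring

end ReciprocalLimit

/-! ### Stieltjes functions as integrals over the unit interval -/

theorem measurable_unitPoint : Measurable unitPoint := by
  refine Measurable.subtype_mk ?_
  fun_prop

theorem IsGenStieltjes.exists_measure {α : ℝ} {f : ℂ → ℂ} (h : IsGenStieltjes α f) :
    ∃ (ρ : Measure unitInterval) (_ : IsFiniteMeasure ρ), ∀ x : ℝ, 0 < x →
      f x = ((∫ t, stieltjesKernel x t ^ α ∂ρ : ℝ) : ℂ) := by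
  obtain ⟨-, a, μ, ha, hμ, hf⟩ := h
  set w : ℝ≥0 → ℝ := fun τ => 1 / (1 + (τ : ℝ)) ^ α
  have hw0 : ∀ τ, 0 ≤ w τ := fun τ => by positivity
  have hwm : Measurable fun τ => ENNReal.ofReal (w τ) := by fun_prop
  have hfin : IsFiniteMeasure (μ.withDensity fun τ => ENNReal.ofReal (w τ)) :=
    isFiniteMeasure_withDensity_ofReal hμ.2
  have hdir := Measure.smul_finite (Measure.dirac (0 : unitInterval)) (c := ENNReal.ofReal a)
      ENNReal.ofReal_ne_top
  -- The point `t = 0` plays the role of `τ = ∞`; there the kernel is `1`. The weight `(1 + τ)^{-α}`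
  -- makes the rest finite.
  refine ⟨ENNReal.ofReal a • Measure.dirac 0 +
    (μ.withDensity fun τ => ENNReal.ofReal (w τ)).map unitPoint, inferInstance, fun x hx => ?_⟩
  have hc : Continuous fun t => stieltjesKernel x t ^ α :=
    (continuous_stieltjesKernel hx).rpow_const fun t => Or.inl (stieltjesKernel_pos hx t).ne'
  have hint : ∀ (ρ : Measure unitInterval) [IsFiniteMeasure ρ],
      Integrable (fun t => stieltjesKernel x t ^ α) ρ := fun ρ _ =>
    hc.integrable_of_hasCompactSupport (HasCompactSupport.of_compactSpace _)
  rw [hf x hx, integral_add_measure (hint _) (hint _), integral_smul_measure, integral_dirac,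
    integral_map measurable_unitPoint.aemeasurable hc.aestronglyMeasurable,
    integral_withDensity_eq_integral_toReal_smul hwm
      (Eventually.of_forall fun τ => ENNReal.ofReal_lt_top), ENNReal.toReal_ofReal ha]
  congr 2
  · simp [stieltjesKernel]
  · congr 1 with τ
    rw [ENNReal.toReal_ofReal (hw0 τ), stieltjesKernel_unitPoint hx,
      Real.div_rpow (by positivity) (by positivity), smul_eq_mul]
    have : (1 + (τ : ℝ)) ^ α ≠ 0 := (Real.rpow_pos_of_pos (by positivity) _).ne'
    simp only [w]
    field_simp

/-! ### Parametrized families of Laplace transforms -/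

/-- `k t` is the Laplace transform of a positive measure depending measurably on `t`, with bounded
total mass. -/
def IsLaplaceFamily (k : unitInterval → ℝ → ℝ) : Prop :=
  ∃ (Ω : Type) (_ : MeasurableSpace Ω) (Q : Measure Ω) (_ : IsFiniteMeasure Q)
    (S : unitInterval × Ω → ℝ≥0) (h : unitInterval × Ω → ℝ) (M : ℝ),
    Measurable S ∧ Measurable h ∧ (∀ w, 0 ≤ h w) ∧ (∀ w, h w ≤ M) ∧
    ∀ t x, 0 < x → k t x = ∫ ω, h (t, ω) * Real.exp (-(S (t, ω) : ℝ) * x) ∂Q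

theorem exp_neg_mul_le_one (s : ℝ≥0) {x : ℝ} (hx : 0 < x) : Real.exp (-(s : ℝ) * x) ≤ 1 := by
  rw [Real.exp_le_one_iff]
  have : 0 ≤ (s : ℝ) * x := by positivity
  linarith

/-- Convolution as the law of a sum: exponents add on the product space, so no measurable choice of
measures is needed. -/
theorem IsLaplaceFamily.mul {k₁ k₂ : unitInterval → ℝ → ℝ} (h₁ : IsLaplaceFamily k₁)
    (h₂ : IsLaplaceFamily k₂) : IsLaplaceFamily fun t x => k₁ t x * k₂ t x := by
  obtain ⟨Ω₁, _, Q₁, _, S₁, h₁, M₁, hS₁, hh₁, hp₁, hM₁, hk₁⟩ := h₁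
  obtain ⟨Ω₂, _, Q₂, _, S₂, h₂, M₂, hS₂, hh₂, hp₂, hM₂, hk₂⟩ := h₂
  refine ⟨Ω₁ × Ω₂, inferInstance, Q₁.prod Q₂, inferInstance,
    fun w => S₁ (w.1, w.2.1) + S₂ (w.1, w.2.2), fun w => h₁ (w.1, w.2.1) * h₂ (w.1, w.2.2),
    M₁ * M₂, by fun_prop, by fun_prop, fun w => mul_nonneg (hp₁ _) (hp₂ _),
    fun w => mul_le_mul (hM₁ _) (hM₂ _) (hp₂ _) ((hp₁ (w.1, w.2.1)).trans (hM₁ _)),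
    fun t x hx => ?_⟩
  beta_reduce
  rw [hk₁ t x hx, hk₂ t x hx, ← integral_prod_mul]
  congr 1 with w
  push_cast
  rw [neg_add, add_mul, Real.exp_add]
  ring

/-- The exponential law scaled by `r t`; the value `r t = 0` needs no separate treatment. -/
theorem isLaplaceFamily_div {c : unitInterval → ℝ} {r : unitInterval → ℝ≥0} {M : ℝ}
    (hc : Measurable c) (hr : Measurable r) (hc0 : ∀ t, 0 ≤ c t) (hcM : ∀ t, c t ≤ M) :
    IsLaplaceFamily fun t x => c t / (1 + r t * x) := by
  refine ⟨ℝ≥0, inferInstance, expDecay 1, isFiniteMeasure_expDecay one_pos,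
    fun w => r w.1 * w.2, fun w => c w.1, M, by fun_prop, by fun_prop, fun w => hc0 _,
    fun w => hcM _, fun t x hx => ?_⟩
  have h1 : 0 ≤ ((((r t : ℝ) * x : ℝ) : ℂ)).re := by
    rw [Complex.ofReal_re]
    positivity
  have h2 := integral_laplace_kernel_expDecay one_pos h1
  rw [integral_laplace_kernel_ofReal] at h2
  have h3 : ∫ s : ℝ≥0, Real.exp (-(s : ℝ) * (r t * x)) ∂(expDecay 1) = 1 / (1 + r t * x) := by
    exact_mod_cast h2
  dsimp only
  rw [integral_const_mul, div_eq_mul_one_div, ← h3]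
  congr 2 with s
  push_cast
  ring_nf

/-- The measure sought is the image under `S` of `h` times the product measure; Fubini identifies
its transform. -/
theorem IsLaplaceFamily.integrable_and_exists {k : unitInterval → ℝ → ℝ} (hk : IsLaplaceFamily k)
    (σ : Measure unitInterval) [IsFiniteMeasure σ] :
    (∀ x : ℝ, 0 < x → Integrable (fun t => k t x) σ) ∧
      ∃ ν : ComplexMeasure ℝ≥0, ∀ x : ℝ, 0 < x → laplace ν x = ((∫ t, k t x ∂σ : ℝ) : ℂ) := by
  obtain ⟨Ω, _, Q, _, S, h, M, hS, hh, hp, hM, hk⟩ := hk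
  have hint : ∀ x : ℝ, 0 < x →
      Integrable (fun w : unitInterval × Ω => h w * Real.exp (-(S w : ℝ) * x)) (σ.prod Q) := by
    intro x hx
    refine Integrable.of_bound (Measurable.aestronglyMeasurable (by fun_prop)) M
      (Eventually.of_forall fun w => ?_)
    rw [norm_mul, Real.norm_of_nonneg (hp w), Real.norm_of_nonneg (Real.exp_nonneg _)]
    exact (mul_le_of_le_one_right (hp w) (exp_neg_mul_le_one _ hx)).trans (hM w)
  have hh' : Integrable h (σ.prod Q) := Integrable.of_bound hh.aestronglyMeasurable M
    (Eventually.of_forall fun w => by rw [Real.norm_of_nonneg (hp w)]; exact hM w)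
  have hfin : IsFiniteMeasure ((σ.prod Q).withDensity fun w => ENNReal.ofReal (h w)) :=
    isFiniteMeasure_withDensity_ofReal hh'.2
  refine ⟨fun x hx => ?_, ofMeasure 1
    (((σ.prod Q).withDensity fun w => ENNReal.ofReal (h w)).map S), fun x hx => ?_⟩
  · exact (hint x hx).integral_prod_left.congr (Eventually.of_forall fun t => (hk t x hx).symm)
  · rw [laplace_ofMeasure _ _ (by simpa using hx.le), one_mul, integral_laplace_kernel_ofReal,
      integral_map hS.aemeasurable (Continuous.aestronglyMeasurable (by fun_prop)),
      integral_withDensity_eq_integral_toReal_smul (by fun_prop)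
        (Eventually.of_forall fun w => ENNReal.ofReal_lt_top)]
    congr 1
    have h1 : ∀ w, (ENNReal.ofReal (h w)).toReal • Real.exp (-(S w : ℝ) * x)
        = h w * Real.exp (-(S w : ℝ) * x) := fun w => by
      rw [ENNReal.toReal_ofReal (hp w), smul_eq_mul]
    simp only [h1]
    rw [integral_prod _ (hint x hx)]
    exact integral_congr_ae (Eventually.of_forall fun t => (hk t x hx).symm)

/-- The kernel `z / ((1 + z) (t z + 1 - t))` is a difference of two families of Laplace
transforms of positive measures. -/
theorem exists_isLaplaceFamily_sub : ∃ k₁ k₂ : unitInterval → ℝ → ℝ,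
    IsLaplaceFamily k₁ ∧ IsLaplaceFamily k₂ ∧
    ∀ t x, 0 < x → x * stieltjesKernel x t / (1 + x) = k₁ t x - k₂ t x := by
  set q : unitInterval → ℝ≥0 := fun t => ((t : ℝ) / (1 - t)).toNNReal
  set m : unitInterval → ℝ := fun t => max (t : ℝ) (1 - t)
  have hm : ∀ t, 1 / 2 ≤ m t := fun t => by
    rcases le_total (t : ℝ) (1 / 2) with h | h
    · exact le_max_of_le_right (by linarith)
    · exact le_max_of_le_left h
  have hm0 : ∀ t, 0 < m t := fun t => by linarith [hm t]
  have hm2 : ∀ t, 1 / m t ≤ 2 := fun t => by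
    rw [div_le_iff₀ (hm0 t)]
    linarith [hm t]
  have hqm : Measurable q := by fun_prop
  have hmm : Measurable m := by fun_prop
  -- With `q = t / (1 - t)` one has `t x + 1 - t = (1 - t)(1 + q x)`. Splitting `x / ((1 + x)(1 + q
  -- x))` as a difference from `1 / (1 + q x)` for `t ≤ 1/2`, and from `1 / (1 + x)` for `t > 1/2`,
  -- keeps the coefficients at most `2`. At `t = 1` the second term is switched off.
  refine ⟨fun t x => 1 / m t / (1 + ((if (t : ℝ) ≤ 1 / 2 then q t else 1 : ℝ≥0) : ℝ) * x),
    fun t x => (if (t : ℝ) < 1 then 1 / m t else 0) / (1 + ((1 : ℝ≥0) : ℝ) * x) *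
      (1 / (1 + q t * x)), ?_, ?_, ?_⟩
  · refine isLaplaceFamily_div (by fun_prop) ?_ (fun t => (by have := hm0 t; positivity)) hm2
    exact Measurable.ite (measurableSet_le (by fun_prop) (by fun_prop)) hqm measurable_const
  · refine (isLaplaceFamily_div (M := 2) ?_ measurable_const ?_ ?_).mul
      (isLaplaceFamily_div (M := 1) measurable_const hqm (fun _ => zero_le_one) fun _ => le_rfl)
    · exact Measurable.ite (measurableSet_lt (by fun_prop) (by fun_prop)) (by fun_prop)
        measurable_const
    · intro t
      have := hm0 t
      split_ifs <;> positivity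
    · intro t
      split_ifs
      · exact hm2 t
      · exact zero_le_two
  · intro t x hx
    have ht0 : (0 : ℝ) ≤ t := t.2.1
    have ht1 : (t : ℝ) ≤ 1 := t.2.2
    simp only [stieltjesKernel, NNReal.coe_one, one_mul]
    rcases ht1.lt_or_eq with ht | ht
    · have hs : (0 : ℝ) < 1 - t := by linarith
      have hq : (q t : ℝ) = t / (1 - t) := Real.coe_toNNReal _ (by positivity)
      have hd : (0 : ℝ) < t * x + (1 - t) := by positivity
      have hq' : 1 + (q t : ℝ) * x = (t * x + (1 - t)) / (1 - t) := by
        rw [hq]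
        field_simp
        ring
      rw [if_pos ht]
      split_ifs with h
      · have h1 : m t = 1 - t := max_eq_right (by linarith)
        rw [h1, hq']
        field_simp
        ring
      · have h1 : m t = t := max_eq_left (by linarith)
        have h2 : (0 : ℝ) < t := by linarith
        rw [h1, hq', NNReal.coe_one, one_mul]
        field_simp
        ring
    · have h1 : m t = 1 := by simp [m, ht]
      rw [if_neg (by linarith), if_neg (by linarith), h1, ht]
      simp
      field_simp

theorem exists_laplace_eq_integral_kernel (σ : Measure unitInterval) [IsFiniteMeasure σ] :
    ∃ ν : ComplexMeasure ℝ≥0, ∀ x : ℝ, 0 < x →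
      laplace ν x = ((x * (∫ t, stieltjesKernel x t ∂σ) / (1 + x) : ℝ) : ℂ) := by
  obtain ⟨k₁, k₂, h₁, h₂, hk⟩ := exists_isLaplaceFamily_sub
  obtain ⟨hi₁, ν₁, hν₁⟩ := h₁.integrable_and_exists σ
  obtain ⟨hi₂, ν₂, hν₂⟩ := h₂.integrable_and_exists σ
  refine ⟨ν₁ - ν₂, fun x hx => ?_⟩
  rw [laplace_sub _ _ (by simpa using hx.le), hν₁ x hx, hν₂ x hx, ← Complex.ofReal_sub,
    ← integral_sub (hi₁ x hx) (hi₂ x hx), ← integral_const_mul, ← integral_div]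
  simp only [hk _ x hx]

theorem exists_laplace_eq_integral_kernel_sq (ρ : Measure unitInterval) [IsFiniteMeasure ρ] :
    ∃ ν : ComplexMeasure ℝ≥0, ∀ x : ℝ, 0 < x →
      laplace ν x = ((x ^ 2 / (1 + x) ^ 2 * ∫ t, stieltjesKernel x t ^ 2 ∂ρ : ℝ) : ℂ) := by
  obtain ⟨k₁, k₂, h₁, h₂, hk⟩ := exists_isLaplaceFamily_sub
  obtain ⟨hi₁₁, ν₁₁, hν₁₁⟩ := (h₁.mul h₁).integrable_and_exists ρ
  obtain ⟨hi₁₂, ν₁₂, hν₁₂⟩ := (h₁.mul h₂).integrable_and_exists ρ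
  obtain ⟨hi₂₂, ν₂₂, hν₂₂⟩ := (h₂.mul h₂).integrable_and_exists ρ
  -- The expansion of `(k₁ - k₂)²`.
  refine ⟨ν₁₁ - ν₁₂ - (ν₁₂ - ν₂₂), fun x hx => ?_⟩
  have hx' : 0 ≤ (x : ℂ).re := by simpa using hx.le
  rw [laplace_sub _ _ hx', laplace_sub _ _ hx', laplace_sub _ _ hx', hν₁₁ x hx, hν₁₂ x hx,
    hν₂₂ x hx, ← Complex.ofReal_sub, ← Complex.ofReal_sub, ← Complex.ofReal_sub,
    ← integral_sub (hi₁₁ x hx) (hi₁₂ x hx), ← integral_sub (hi₁₂ x hx) (hi₂₂ x hx),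
    ← integral_sub (f := fun t => k₁ t x * k₁ t x - k₁ t x * k₂ t x)
      (g := fun t => k₁ t x * k₂ t x - k₂ t x * k₂ t x)
      ((hi₁₁ x hx).sub (hi₁₂ x hx)) ((hi₁₂ x hx).sub (hi₂₂ x hx)), ← integral_const_mul]
  congr 2 with t
  have := hk t x hx
  rw [← div_pow, ← mul_pow, div_mul_eq_mul_div, this]
  ring

/-! ### The main theorem -/

theorem rightHalfPlane_subset_slitPlane : rightHalfPlane ⊆ Complex.slitPlane :=
  fun _ hz => Or.inl hz

theorem one_add_ne_zero_of_mem {z : ℂ} (hz : z ∈ rightHalfPlane) : 1 + z ≠ 0 := fun h => by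
  have := congrArg Complex.re h
  have hz' : 0 < z.re := hz
  simp at this
  linarith

theorem IsGenStieltjes.memA1_sq_div_sq_mul {f : ℂ → ℂ} (h : IsGenStieltjes 2 f) :
    MemA1 (fun z => z ^ 2 / (1 + z) ^ 2 * f z) := by
  obtain ⟨ρ, _, hρ⟩ := h.exists_measure
  obtain ⟨ν, hν⟩ := exists_laplace_eq_integral_kernel_sq ρ
  refine ⟨ν, IsLaplaceOf.of_eq_ofReal ?_ fun x hx => ?_⟩
  · refine DifferentiableOn.mul ?_ (h.1.mono rightHalfPlane_subset_slitPlane)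
    exact DifferentiableOn.div (by fun_prop) (by fun_prop) fun z hz =>
      pow_ne_zero 2 (one_add_ne_zero_of_mem hz)
  · rw [hν x hx, hρ x hx]
    simp only [Real.rpow_two]
    push_cast
    rfl

theorem IsGenStieltjes.exists_laplace_inv {f : ℂ → ℂ} (h : IsGenStieltjes 1 f) {x₀ : ℝ}
    (hx₀ : 0 < x₀) (hf : f x₀ ≠ 0) :
    ∃ ν : ComplexMeasure ℝ≥0, ∀ x : ℝ, 0 < x → (1 + x) * f x * laplace ν x = 1 := by
  obtain ⟨ρ, _, hρ⟩ := h.exists_measure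
  have hρ0 : ρ ≠ 0 := by
    rintro rfl
    exact hf (by simp [hρ x₀ hx₀])
  obtain ⟨σ, _, hσ⟩ := exists_measure_reciprocal ρ hρ0
  obtain ⟨ν, hν⟩ := exists_laplace_eq_integral_kernel σ
  refine ⟨ν, fun x hx => ?_⟩
  rw [hν x hx, hρ x hx]
  simp only [Real.rpow_one]
  have h1 : (1 + x) * (∫ t, stieltjesKernel x t ∂ρ) *
      (x * (∫ t, stieltjesKernel x t ∂σ) / (1 + x)) = 1 := by
    refine Eq.trans ?_ (hσ x hx)
    field_simp
  exact_mod_cast h1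

theorem IsStieltjesProd.differentiableOn {f : ℂ → ℂ} (h : IsStieltjesProd f) :
    DifferentiableOn ℂ f rightHalfPlane := by
  obtain ⟨f₁, f₂, h₁, h₂, hf⟩ := h
  exact ((h₁.1.mul h₂.1).congr hf).mono rightHalfPlane_subset_slitPlane

/-- Stating the identity as a product equal to `1` also shows that `f` has no zero in the
half-plane, so that `1 / f` is holomorphic there. -/
theorem IsStieltjesProd.exists_laplace_inv {f : ℂ → ℂ} (h : IsStieltjesProd f)
    (h0 : ∃ x : ℝ, 0 < x ∧ f (x : ℂ) ≠ 0) :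
    ∃ ν : ComplexMeasure ℝ≥0, ∀ z ∈ rightHalfPlane, (1 + z) ^ 2 * f z * laplace ν z = 1 := by
  have hd := h.differentiableOn
  obtain ⟨f₁, f₂, h₁, h₂, hf⟩ := h
  obtain ⟨x₀, hx₀, hfx₀⟩ := h0
  have hf' : ∀ x : ℝ, 0 < x → f x = f₁ x * f₂ x := fun x hx =>
    hf x (rightHalfPlane_subset_slitPlane (ofReal_mem_rightHalfPlane hx))
  rw [hf' x₀ hx₀] at hfx₀
  obtain ⟨ν₁, hν₁⟩ := h₁.exists_laplace_inv hx₀ (left_ne_zero_of_mul hfx₀)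
  obtain ⟨ν₂, hν₂⟩ := h₂.exists_laplace_inv hx₀ (right_ne_zero_of_mul hfx₀)
  obtain ⟨ν, hν, -⟩ := exists_conv.{0} ν₁ ν₂
  refine ⟨ν, eqOn_rightHalfPlane_of_eq_ofReal (g := fun _ => 1) ?_ (by fun_prop) fun x hx => ?_⟩
  · exact (DifferentiableOn.mul (by fun_prop) hd).mul (differentiableOn_laplace ν)
  · rw [hf' x hx, hν x (by simpa using hx.le)]
    linear_combination (1 + (x : ℂ)) * f₂ x * laplace ν₂ x * hν₁ x hx + hν₂ x hx

theorem proposition4p1 {X : Type*} [NormedAddCommGroup X] [NormedSpace ℂ X] [CompleteSpace X]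
    (T : BoundedC0Semigroup X) (A : X →ₗ.[ℂ] X) (hA : T.generator = -A)
    (hran : Dense (LinearMap.range A.toFun : Set X)) :
    (∀ f : ℂ → ℂ, IsGenStieltjes 2 f →
      T.IsRegularizer (fun z => z ^ 2 / (1 + z) ^ 2) f ∧
      T.IsRegularizable f ∧
      (T.extHP f).HasCore (LinearMap.range (A.pcomp A).toFun)) ∧
    (∀ f : ℂ → ℂ, IsStieltjesProd f → (∃ x : ℝ, 0 < x ∧ f (x : ℂ) ≠ 0) →
      T.IsRegularizer (fun z => 1 / (1 + z) ^ 2) (fun z => 1 / f z) ∧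
      T.IsRegularizable (fun z => 1 / f z) ∧
      (T.extHP (fun z => 1 / f z)).HasCore (A.pcomp A).domain) := by
  constructor
  · intro f hf
    have hinj := BoundedC0Semigroup.injective_one_sub_resolvent hA hran
    have hreg : T.IsRegularizer (fun z => z ^ 2 / (1 + z) ^ 2) f :=
      { holomorphic := hf.1.mono rightHalfPlane_subset_slitPlane
        memA1 := BoundedC0Semigroup.memA1_sq_div_sq
        memA1_mul := hf.memA1_sq_div_sq_mul
        injective := by
          rw [BoundedC0Semigroup.hp_sq_div_sq]
          exact hinj.comp hinj }
    exact ⟨hreg, ⟨_, hreg⟩,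
      BoundedC0Semigroup.hasCore_range_sq hA hran hreg BoundedC0Semigroup.hp_sq_div_sq⟩
  · intro f hf h0
    have hinj := BoundedC0Semigroup.injective_resolvent (T := T) one_pos
    obtain ⟨ν, hν⟩ := hf.exists_laplace_inv h0
    have hf0 : ∀ z ∈ rightHalfPlane, f z ≠ 0 := fun z hz h => by
      have := hν z hz
      simp [h] at this
    have hreg : T.IsRegularizer (fun z => 1 / (1 + z) ^ 2) (fun z => 1 / f z) :=
      { holomorphic := (differentiableOn_const 1).div hf.differentiableOn hf0
        memA1 := BoundedC0Semigroup.memA1_one_div_sq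
        memA1_mul := ⟨ν, fun z hz => by
          have h1 := hf0 z hz
          have h2 := one_add_ne_zero_of_mem hz
          have h3 := hν z hz
          field_simp
          linear_combination -h3⟩
        injective := by
          rw [BoundedC0Semigroup.hp_one_div_sq]
          exact hinj.comp hinj }
    exact ⟨hreg, ⟨_, hreg⟩,
      BoundedC0Semigroup.hasCore_domain_sq hA hreg BoundedC0Semigroup.hp_one_div_sq⟩
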